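/- Let $k$ be an algebraically closed field of characteristic zero and let $\mathcal C$ be a fusion category over $k$ (a $k$-linear abelian semisimple rigid tensor category with finitely many isomorphism classes of simple objects, finite-dimensional spaces of morphisms and simple unit object $\mathbf 1$). Let $G$ be a finite group with identity $e$, let $\omega$ be a 3-cocycle of $\mathbb Z_2$ with values in $k^\times$ (trivial action), and let $\mathrm{Vec}_{\mathbb Z_2}^{\omega}$ be the category of finite-dimensional $\mathbb Z_2$-graded vector spaces with associativity given by $\omega$. Suppose that $\mathcal C$ is a $G$-extension of $\mathrm{Vec}_{\mathbb Z_2}^{\omega}$: there is a faithful grading $\mathcal C=\bigoplus_{g\in G}\mathcal C_g$ (a decomposition into full abelian subcategories with $\mathcal C_g\ne 0$, $\mathcal C_g\otimes\mathcal C_h\subseteq\mathcal C_{gh}$ and $(\mathcal C_g)^*=\mathcal C_{g^{-1}}$ for all $g,h$) whose trivial component $\mathcal C_e$ is equivalent to $\mathrm{Vec}_{\mathbb Z_2}^{\omega}$ as a $k$-linear tensor category. A simple object $X$ is invertible if $X\otimes X^*\cong\mathbf 1$; $\mathcal C$ is pointed if all its simple objects are invertible; $\mathcal C$ is a generalized Tambara–Yamagami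 category if it is not pointed and the tensor product of any two non-invertible simple objects is a direct sum of invertible objects. $G(\mathcal C)$ is the group of isomorphism classes of invertible objects; $\mathcal C_{ad}$ is the fusion subcategory generated by the simple summands of $X\otimes X^*$ for all simple $X$; $U(\mathcal C)$ is the universal grading group of $\mathcal C$, i.e. the grading group of the universal grading of $\mathcal C$, from which every other grading of $\mathcal C$ is induced by a unique group homomorphism. Then: 1. If the class of $\omega$ in $H^3(\mathbb Z_2,k^\times)$ is nontrivial, then $\mathcal C$ is pointed. 2. If the class of $\omega$ is trivial, then $\mathcal C$ is either pointed or a generalized Tambara–Yamagami category. If $\mathcal C$ is a generalized Tambara–Yamagami category, then there is an integer $n\geq 1$ such that: (i) $|G(\mathcal C)|=2n$ and $\mathcal C$ is of type $(1,2n;\sqrt2,n)$, i.e. it has, up to isomorphism, exactly $2n$ simple objects of Frobenius–Perron dimension $1$, exactly $n$ simple objects of Frobenius–Perron dimension $\sqrt2$, and no other simple objects; (ii) $\mathcal C_e=\mathcal C_{ad}$; the grading $\mathcal C=\bigoplus_{g\in G}\mathcal C_g$ is the universal grading, that is, there is an isomorphism $U(\mathcal C)\cong G$ which identifies the components of the universal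 grading with those of the given one; and $|U(\mathcal C)|=2n$. -/

import Mathlib

open CategoryTheory MonoidalCategory Limits
open scoped TensorProduct

universe u v w t

/-- A 3-cocycle of a group `Γ` with values in the trivial `Γ`-module `kˣ` (not assumed
normalized). -/
structure ThreeCocycle (Γ : Type v) [Group Γ] (k : Type u) [Field k] where
  toFun : Γ → Γ → Γ → kˣ
  cocycle : ∀ a b c d : Γ,
    toFun a b c * toFun a (b * c) d * toFun b c d = toFun (a * b) c d * toFun a b (c * d)

namespace ThreeCocycle

variable {Γ : Type v} [Group Γ] {k : Type u} [Field k]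

instance : CoeFun (ThreeCocycle Γ k) (fun _ => Γ → Γ → Γ → kˣ) := ⟨toFun⟩

/-- The class of `ω` in `H³(Γ, kˣ)` is trivial, i.e. `ω` is the coboundary of a 2-cochain. -/
def IsTrivial (ω : ThreeCocycle Γ k) : Prop :=
  ∃ η : Γ → Γ → kˣ, ∀ a b c : Γ, ω a b c = η b c * (η (a * b) c)⁻¹ * η a (b * c) * (η a b)⁻¹

theorem mid (ω : ThreeCocycle Γ k) (a b : Γ) : ω a 1 b = ω a 1 1 * ω 1 1 b := by
  have h := ω.cocycle a 1 1 b
  simp only [mul_one, one_mul] at h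
  have h2 : ω a 1 b * (ω a 1 1 * ω 1 1 b) = ω a 1 b * ω a 1 b := by
    rw [← h, mul_comm (ω a 1 1) (ω a 1 b), mul_assoc]
  exact (mul_left_cancel h2).symm

end ThreeCocycle

/-- Objects of `Vec_Γ^ω`: finite-dimensional `Γ`-graded `k`-vector spaces. The grading is given
by the projections `proj a` onto the homogeneous components. -/
structure TwistedVect {Γ : Type v} [Group Γ] [Fintype Γ] {k : Type u} [Field k]
    (ω : ThreeCocycle Γ k) where
  carrier : Type u
  [addCommGroup : AddCommGroup carrier]
  [module : Module k carrier]
  [finiteDimensional : FiniteDimensional k carrier]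
  proj : Γ → Module.End k carrier
  isComplete : CompleteOrthogonalIdempotents proj

namespace TwistedVect

variable {Γ : Type v} [Group Γ] [Fintype Γ] {k : Type u} [Field k] {ω : ThreeCocycle Γ k}

attribute [instance] addCommGroup module finiteDimensional

/-- Morphisms of graded vector spaces: linear maps preserving degrees. -/
@[ext]
structure Hom (V W : TwistedVect ω) where
  lin : V.carrier →ₗ[k] W.carrier
  comm : ∀ (a : Γ) (v : V.carrier), lin (V.proj a v) = W.proj a (lin v)

instance : Category (TwistedVect ω) where
  Hom V W := Hom V W
  id V := ⟨LinearMap.id, fun _ _ => rfl⟩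
  comp f g := ⟨g.lin ∘ₗ f.lin, fun a v => by simp [f.comm, g.comm]⟩

/-- The linear map underlying a morphism. -/
def toLin {V W : TwistedVect ω} (f : V ⟶ W) : V.carrier →ₗ[k] W.carrier := Hom.lin f

/-- A degree-preserving linear map as a morphism. -/
def ofLin {V W : TwistedVect ω} (f : V.carrier →ₗ[k] W.carrier)
    (h : ∀ (a : Γ) (v : V.carrier), f (V.proj a v) = W.proj a (f v)) : V ⟶ W := Hom.mk f h

section basics

variable {V W X : TwistedVect ω}

@[simp] theorem toLin_ofLin (f : V.carrier →ₗ[k] W.carrier)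
    (h : ∀ (a : Γ) (v : V.carrier), f (V.proj a v) = W.proj a (f v)) :
    toLin (ofLin f h) = f := rfl

@[simp] theorem toLin_id : toLin (𝟙 V) = LinearMap.id := rfl

@[simp] theorem toLin_comp (f : V ⟶ W) (g : W ⟶ X) : toLin (f ≫ g) = toLin g ∘ₗ toLin f := rfl

theorem toLin_comm (f : V ⟶ W) (a : Γ) (v : V.carrier) :
    toLin f (V.proj a v) = W.proj a (toLin f v) := Hom.comm f a v

theorem toLin_injective : Function.Injective (toLin : (V ⟶ W) → _) := fun _ _ h => Hom.ext h

end basics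

instance (V W : TwistedVect ω) : Zero (V ⟶ W) := ⟨ofLin 0 (by simp)⟩
instance (V W : TwistedVect ω) : Add (V ⟶ W) :=
  ⟨fun f g => ofLin (toLin f + toLin g) (by simp [toLin_comm])⟩
instance (V W : TwistedVect ω) : Neg (V ⟶ W) := ⟨fun f => ofLin (-toLin f) (by simp [toLin_comm])⟩
instance (V W : TwistedVect ω) : Sub (V ⟶ W) :=
  ⟨fun f g => ofLin (toLin f - toLin g) (by simp [toLin_comm])⟩
instance (V W : TwistedVect ω) : SMul ℕ (V ⟶ W) :=
  ⟨fun n f => ofLin (n • toLin f) (by simp [toLin_comm])⟩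
instance (V W : TwistedVect ω) : SMul ℤ (V ⟶ W) :=
  ⟨fun n f => ofLin (n • toLin f) (by simp [toLin_comm])⟩
instance (V W : TwistedVect ω) : SMul k (V ⟶ W) :=
  ⟨fun c f => ofLin (c • toLin f) (by simp [toLin_comm])⟩

instance (V W : TwistedVect ω) : AddCommGroup (V ⟶ W) :=
  Function.Injective.addCommGroup toLin toLin_injective rfl (fun _ _ => rfl) (fun _ => rfl)
    (fun _ _ => rfl) (fun _ _ => rfl) (fun _ _ => rfl)

@[simp] theorem toLin_add {V W : TwistedVect ω} (f g : V ⟶ W) :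
    toLin (f + g) = toLin f + toLin g := rfl

@[simp] theorem toLin_smul {V W : TwistedVect ω} (c : k) (f : V ⟶ W) :
    toLin (c • f) = c • toLin f := rfl

instance (V W : TwistedVect ω) : Module k (V ⟶ W) :=
  Function.Injective.module k (⟨⟨toLin, rfl⟩, fun _ _ => rfl⟩ : (V ⟶ W) →+ _)
    toLin_injective (fun _ _ => rfl)

instance : Preadditive (TwistedVect ω) where
  add_comp _ _ _ f f' g := toLin_injective (by simp [LinearMap.comp_add])
  comp_add _ _ _ f g g' := toLin_injective (by simp [LinearMap.add_comp])

instance : Linear k (TwistedVect ω) where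
  smul_comp _ _ _ c f g := toLin_injective (by simp [LinearMap.comp_smul])
  comp_smul _ _ _ f c g := toLin_injective (by simp [LinearMap.smul_comp])

open Classical in
theorem proj_proj (V : TwistedVect ω) (a b : Γ) (v : V.carrier) :
    V.proj a (V.proj b v) = if a = b then V.proj a v else 0 := by
  have h := DFunLike.congr_fun (V.isComplete.mul_eq a b) v
  split_ifs with hab <;> simpa [hab] using h

theorem sum_proj (V : TwistedVect ω) (v : V.carrier) : ∑ a, V.proj a v = v := by
  simpa using DFunLike.congr_fun V.isComplete.complete v

/-- `v` is homogeneous of degree `a`. -/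
def IsHomog {V : TwistedVect ω} (a : Γ) (v : V.carrier) : Prop := V.proj a v = v

theorem isHomog_proj (V : TwistedVect ω) (a : Γ) (v : V.carrier) : IsHomog a (V.proj a v) := by
  simp [IsHomog, proj_proj]

open Classical in
theorem IsHomog.proj_eq {V : TwistedVect ω} {a : Γ} {v : V.carrier} (h : IsHomog a v) (b : Γ) :
    V.proj b v = if b = a then v else 0 := by
  rw [← show V.proj a v = v from h, proj_proj]
  split_ifs with hb
  · rw [hb]
  · rfl

theorem hom_ext {V : TwistedVect ω} {M : Type*} [AddCommGroup M] [Module k M]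
    {f g : V.carrier →ₗ[k] M} (h : ∀ (a : Γ) (v : V.carrier), IsHomog a v → f v = g v) : f = g := by
  ext v
  rw [← V.sum_proj v, map_sum, map_sum]
  exact Finset.sum_congr rfl fun a _ => h a _ (V.isHomog_proj a v)

theorem tensor_ext {V W : TwistedVect ω} {M : Type*} [AddCommGroup M] [Module k M]
    {f g : V.carrier ⊗[k] W.carrier →ₗ[k] M}
    (h : ∀ (a b : Γ) (v : V.carrier) (w : W.carrier), IsHomog a v → IsHomog b w →
      f (v ⊗ₜ w) = g (v ⊗ₜ w)) : f = g := by
  apply TensorProduct.ext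
  refine hom_ext fun a v hv => ?_
  refine hom_ext fun b w hw => ?_
  exact h a b v w hv hw

/-- The projection of `V ⊗ W` onto its component of degree `a`, which is
`⨁_{b * c = a} V_b ⊗ W_c`. -/
def tensorProj (V W : TwistedVect ω) (a : Γ) : Module.End k (V.carrier ⊗[k] W.carrier) :=
  ∑ b, TensorProduct.map (V.proj b) (W.proj (b⁻¹ * a))

open Classical in
theorem tensorProj_apply {V W : TwistedVect ω} {a b : Γ} {v : V.carrier} {w : W.carrier}
    (hv : IsHomog a v) (hw : IsHomog b w) (c : Γ) :
    tensorProj V W c (v ⊗ₜ w) = if c = a * b then v ⊗ₜ w else 0 := by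
  simp only [tensorProj, LinearMap.sum_apply, TensorProduct.map_tmul, hv.proj_eq, hw.proj_eq]
  rw [Finset.sum_eq_single a]
  · by_cases h : c = a * b
    · simp [h]
    · have : ¬ a⁻¹ * c = b := fun h' => h (by rw [← h']; simp)
      simp [h, this]
  · intro d _ hd
    simp [hd]
  · simp

/-- The tensor product of graded vector spaces. -/
abbrev tensor (V W : TwistedVect ω) : TwistedVect ω where
  carrier := V.carrier ⊗[k] W.carrier
  proj := tensorProj V W
  isComplete := by
    classical
    rw [CompleteOrthogonalIdempotents.iff_ortho_complete]
    constructor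
    · intro c d hcd
      refine tensor_ext fun a b v w hv hw => ?_
      simp only [Module.End.mul_apply, tensorProj_apply hv hw, LinearMap.zero_apply]
      by_cases hd : d = a * b
      · have hc : ¬ c = a * b := fun h => hcd (h.trans hd.symm)
        rw [if_pos hd, tensorProj_apply hv hw, if_neg hc]
      · rw [if_neg hd, map_zero]
    · refine tensor_ext fun a b v w hv hw => ?_
      simp [LinearMap.sum_apply, tensorProj_apply hv hw]

theorem IsHomog.tmul {V W : TwistedVect ω} {a b : Γ} {v : V.carrier} {w : W.carrier}
    (hv : IsHomog a v) (hw : IsHomog b w) : IsHomog (V := tensor V W) (a * b) (v ⊗ₜ[k] w) := by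
  classical
  exact (tensorProj_apply hv hw (a * b)).trans (if_pos rfl)

theorem IsHomog.toLin {V W : TwistedVect ω} {a : Γ} {v : V.carrier} (hv : IsHomog a v)
    (f : V ⟶ W) : IsHomog a (toLin f v) := by
  unfold IsHomog
  rw [← toLin_comm, show V.proj a v = v from hv]

theorem IsHomog.smul {V : TwistedVect ω} {a : Γ} {v : V.carrier} (hv : IsHomog a v)
    (c : k) : IsHomog a (c • v) := by
  unfold IsHomog
  rw [map_smul, show V.proj a v = v from hv]

/-- Constructor for morphisms: it is enough to send homogeneous elements to homogeneous ones. -/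
def ofHomog {V W : TwistedVect ω} (f : V.carrier →ₗ[k] W.carrier)
    (h : ∀ (a : Γ) (v : V.carrier), IsHomog a v → IsHomog a (f v)) : V ⟶ W :=
  ofLin f (by
    classical
    intro a v
    suffices f ∘ₗ V.proj a = W.proj a ∘ₗ f from DFunLike.congr_fun this v
    refine hom_ext fun b v hv => ?_
    simp only [LinearMap.comp_apply, hv.proj_eq, (h b v hv).proj_eq]
    split_ifs <;> simp)

theorem tensor_ext₃ {V W X : TwistedVect ω} {M : Type*} [AddCommGroup M] [Module k M]
    {f g : (V.carrier ⊗[k] W.carrier) ⊗[k] X.carrier →ₗ[k] M}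
    (h : ∀ (a b c : Γ) (v : V.carrier) (w : W.carrier) (x : X.carrier), IsHomog a v →
      IsHomog b w → IsHomog c x → f ((v ⊗ₜ w) ⊗ₜ x) = g ((v ⊗ₜ w) ⊗ₜ x)) : f = g := by
  apply TensorProduct.ext
  refine tensor_ext fun a b v w hv hw => ?_
  exact hom_ext fun c x hx => h a b c v w x hv hw hx

theorem tensor_ext₄ {V W X Y : TwistedVect ω} {M : Type*} [AddCommGroup M] [Module k M]
    {f g : ((V.carrier ⊗[k] W.carrier) ⊗[k] X.carrier) ⊗[k] Y.carrier →ₗ[k] M}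
    (h : ∀ (a b c d : Γ) (v : V.carrier) (w : W.carrier) (x : X.carrier) (y : Y.carrier),
      IsHomog a v → IsHomog b w → IsHomog c x → IsHomog d y →
        f (((v ⊗ₜ w) ⊗ₜ x) ⊗ₜ y) = g (((v ⊗ₜ w) ⊗ₜ x) ⊗ₜ y)) : f = g := by
  apply TensorProduct.ext
  refine tensor_ext₃ fun a b c v w x hv hw hx => ?_
  exact hom_ext fun d y hy => h a b c d v w x y hv hw hx hy

theorem comm_of_comp {V W : TwistedVect ω} {f : V.carrier →ₗ[k] W.carrier}
    (h : ∀ a, f ∘ₗ V.proj a = W.proj a ∘ₗ f) (a : Γ) (v : V.carrier) :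
    f (V.proj a v) = W.proj a (f v) := DFunLike.congr_fun (h a) v

open Classical in
/-- The unit object: `k` in degree `1`. -/
noncomputable abbrev unit (ω : ThreeCocycle Γ k) : TwistedVect ω where
  carrier := k
  proj a := if a = 1 then 1 else 0
  isComplete := by
    rw [CompleteOrthogonalIdempotents.iff_ortho_complete]
    constructor
    · intro a b hab
      by_cases ha : a = 1
      · have hb : ¬ b = 1 := fun h => hab (ha.trans h.symm)
        simp [hb]
      · simp [ha]
    · simp

theorem isHomog_unit (c : k) : IsHomog (V := unit ω) 1 c := by
  simp only [IsHomog, if_true]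
  rfl

theorem tensorMap_comm {V W V' W' : TwistedVect ω} (f : V ⟶ V') (g : W ⟶ W') (a : Γ)
    (t : V.carrier ⊗[k] W.carrier) :
    TensorProduct.map (toLin f) (toLin g) (tensorProj V W a t) =
      tensorProj V' W' a (TensorProduct.map (toLin f) (toLin g) t) := by
  classical
  suffices TensorProduct.map (toLin f) (toLin g) ∘ₗ tensorProj V W a =
      tensorProj V' W' a ∘ₗ TensorProduct.map (toLin f) (toLin g) from DFunLike.congr_fun this t
  refine tensor_ext fun b c v w hv hw => ?_
  rw [LinearMap.comp_apply, LinearMap.comp_apply, tensorProj_apply hv hw, TensorProduct.map_tmul,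
    tensorProj_apply (hv.toLin f) (hw.toLin g)]
  split_ifs <;> simp

/-- The tensor product of two morphisms. -/
def tensorMap {V W V' W' : TwistedVect ω} (f : V ⟶ V') (g : W ⟶ W') :
    tensor V W ⟶ tensor V' W' :=
  ofLin (V := tensor V W) (W := tensor V' W') (TensorProduct.map (toLin f) (toLin g))
    (tensorMap_comm f g)

/-- The associativity map of `Vec_Γ^ω`: on homogeneous elements of degrees `a`, `b`, `c` it is
`(v ⊗ w) ⊗ x ↦ ω a b c • v ⊗ (w ⊗ x)`. -/
def assocLin (V W X : TwistedVect ω) :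
    (V.carrier ⊗[k] W.carrier) ⊗[k] X.carrier →ₗ[k] V.carrier ⊗[k] (W.carrier ⊗[k] X.carrier) :=
  (∑ a, ∑ b, ∑ c, (ω a b c : k) •
    TensorProduct.map (V.proj a) (TensorProduct.map (W.proj b) (X.proj c))) ∘ₗ
      (TensorProduct.assoc k V.carrier W.carrier X.carrier).toLinearMap

/-- The inverse of the associativity map. -/
def assocInvLin (V W X : TwistedVect ω) :
    V.carrier ⊗[k] (W.carrier ⊗[k] X.carrier) →ₗ[k] (V.carrier ⊗[k] W.carrier) ⊗[k] X.carrier :=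
  (TensorProduct.assoc k V.carrier W.carrier X.carrier).symm.toLinearMap ∘ₗ
    (∑ a, ∑ b, ∑ c, ((ω a b c)⁻¹ : kˣ).val •
      TensorProduct.map (V.proj a) (TensorProduct.map (W.proj b) (X.proj c)))

theorem sum_apply_homog {V W X : TwistedVect ω} (θ : Γ → Γ → Γ → k) {a b c : Γ} {v : V.carrier}
    {w : W.carrier} {x : X.carrier} (hv : IsHomog a v) (hw : IsHomog b w) (hx : IsHomog c x) :
    (∑ a, ∑ b, ∑ c, θ a b c •
      TensorProduct.map (V.proj a) (TensorProduct.map (W.proj b) (X.proj c)))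
        (v ⊗ₜ[k] (w ⊗ₜ[k] x)) = θ a b c • (v ⊗ₜ[k] (w ⊗ₜ[k] x)) := by
  classical
  simp only [LinearMap.sum_apply, LinearMap.smul_apply, TensorProduct.map_tmul, hv.proj_eq,
    hw.proj_eq, hx.proj_eq]
  rw [Finset.sum_eq_single a, Finset.sum_eq_single b, Finset.sum_eq_single c]
  · simp
  · intro d _ hd; simp [hd]
  · simp
  · intro d _ hd; simp [hd]
  · simp
  · intro d _ hd; simp [hd]
  · simp

theorem assocLin_apply {V W X : TwistedVect ω} {a b c : Γ} {v : V.carrier}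
    {w : W.carrier} {x : X.carrier} (hv : IsHomog a v) (hw : IsHomog b w) (hx : IsHomog c x) :
    assocLin V W X ((v ⊗ₜ w) ⊗ₜ x) = (ω a b c : k) • (v ⊗ₜ (w ⊗ₜ x)) :=
  sum_apply_homog (fun a b c => (ω a b c : k)) hv hw hx

theorem assocInvLin_apply {V W X : TwistedVect ω} {a b c : Γ} {v : V.carrier}
    {w : W.carrier} {x : X.carrier} (hv : IsHomog a v) (hw : IsHomog b w) (hx : IsHomog c x) :
    assocInvLin V W X (v ⊗ₜ (w ⊗ₜ x)) = ((ω a b c)⁻¹ : kˣ).val • ((v ⊗ₜ w) ⊗ₜ x) := by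
  rw [assocInvLin, LinearMap.comp_apply,
    sum_apply_homog (fun a b c => ((ω a b c)⁻¹ : kˣ).val) hv hw hx]
  simp

theorem tensor_ext₃' {V W X : TwistedVect ω} {M : Type*} [AddCommGroup M] [Module k M]
    {f g : V.carrier ⊗[k] (W.carrier ⊗[k] X.carrier) →ₗ[k] M}
    (h : ∀ (a b c : Γ) (v : V.carrier) (w : W.carrier) (x : X.carrier), IsHomog a v →
      IsHomog b w → IsHomog c x → f (v ⊗ₜ (w ⊗ₜ x)) = g (v ⊗ₜ (w ⊗ₜ x))) : f = g := by
  apply TensorProduct.ext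
  refine hom_ext fun a v hv => ?_
  exact tensor_ext fun b c w x hw hx => h a b c v w x hv hw hx

/-- An isomorphism from a pair of mutually inverse linear maps, the first of which preserves
degrees. -/
def isoOfLin {V W : TwistedVect ω} (f : V.carrier →ₗ[k] W.carrier) (g : W.carrier →ₗ[k] V.carrier)
    (hf : ∀ (a : Γ) (v : V.carrier), f (V.proj a v) = W.proj a (f v))
    (hfg : g ∘ₗ f = LinearMap.id) (hgf : f ∘ₗ g = LinearMap.id) : V ≅ W where
  hom := ofLin f hf
  inv := ofLin g (fun a w => by
    have h1 : ∀ v, g (f v) = v := fun v => DFunLike.congr_fun hfg v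
    have h2 : ∀ w, f (g w) = w := fun w => DFunLike.congr_fun hgf w
    rw [← h1 (V.proj a (g w)), hf, h2])
  hom_inv_id := toLin_injective hfg
  inv_hom_id := toLin_injective hgf

@[simp] theorem toLin_isoOfLin_hom {V W : TwistedVect ω} (f : V.carrier →ₗ[k] W.carrier)
    (g : W.carrier →ₗ[k] V.carrier) (hf hfg hgf) :
    toLin (isoOfLin (V := V) (W := W) f g hf hfg hgf).hom = f := rfl

theorem assocLin_comm (V W X : TwistedVect ω) (d : Γ)
    (t : (V.carrier ⊗[k] W.carrier) ⊗[k] X.carrier) :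
    assocLin V W X (tensorProj (tensor V W) X d t) =
      tensorProj V (tensor W X) d (assocLin V W X t) := by
  classical
  suffices assocLin V W X ∘ₗ tensorProj (tensor V W) X d =
      tensorProj V (tensor W X) d ∘ₗ assocLin V W X from DFunLike.congr_fun this t
  refine tensor_ext₃ fun a b c v w x hv hw hx => ?_
  rw [LinearMap.comp_apply, LinearMap.comp_apply, assocLin_apply hv hw hx,
    tensorProj_apply (V := tensor V W) (hv.tmul hw) hx, map_smul,
    tensorProj_apply (W := tensor W X) hv (hw.tmul hx), mul_assoc]
  split_ifs
  · exact assocLin_apply hv hw hx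
  · simp

/-- The associativity isomorphism. -/
def assocIso (V W X : TwistedVect ω) : tensor (tensor V W) X ≅ tensor V (tensor W X) :=
  isoOfLin (V := tensor (tensor V W) X) (W := tensor V (tensor W X))
    (assocLin V W X) (assocInvLin V W X) (assocLin_comm V W X)
    (tensor_ext₃ fun a b c v w x hv hw hx => by
      simp [assocLin_apply hv hw hx, assocInvLin_apply hv hw hx, smul_smul])
    (tensor_ext₃' fun a b c v w x hv hw hx => by
      simp [assocLin_apply hv hw hx, assocInvLin_apply hv hw hx, smul_smul])

/-- Rescaling of the component of degree `a` by `θ a`, for every `a`. -/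
def rescale (V : TwistedVect ω) (θ : Γ → k) : V.carrier →ₗ[k] V.carrier := ∑ a, θ a • V.proj a

theorem rescale_apply {V : TwistedVect ω} (θ : Γ → k) {a : Γ} {v : V.carrier}
    (hv : IsHomog a v) : rescale V θ v = θ a • v := by
  classical
  simp only [rescale, LinearMap.sum_apply, LinearMap.smul_apply, hv.proj_eq]
  rw [Finset.sum_eq_single a]
  · simp
  · intro d _ hd; simp [hd]
  · simp

/-- The left unit isomorphism: `r ⊗ v ↦ (ω 1 1 a)⁻¹ • r • v` for `v` of degree `a`. -/
noncomputable def leftUnitIso (V : TwistedVect ω) : tensor (unit ω) V ≅ V :=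
  isoOfLin (V := tensor (unit ω) V) (W := V)
    (rescale V (fun a => ((ω 1 1 a)⁻¹ : kˣ).val) ∘ₗ (TensorProduct.lid k V.carrier).toLinearMap)
    ((TensorProduct.lid k V.carrier).symm.toLinearMap ∘ₗ rescale V (fun a => (ω 1 1 a : k)))
    (comm_of_comp (by
      classical
      intro d
      refine tensor_ext (V := unit ω) fun a b r v hr hv => ?_
      change rescale V _ (TensorProduct.lid k V.carrier
          ((tensor (unit ω) V).proj d (r ⊗ₜ[k] v))) =
        V.proj d (rescale V _ (TensorProduct.lid k V.carrier (r ⊗ₜ[k] v)))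
      have hr : IsHomog (V := unit ω) 1 r := isHomog_unit r
      have hp : (tensor (unit ω) V).proj d (r ⊗ₜ[k] v) = if d = b then r ⊗ₜ[k] v else 0 := by
        have := (hr.tmul hv).proj_eq d
        rwa [one_mul] at this
      rw [hp, TensorProduct.lid_tmul, map_smul, rescale_apply _ hv, map_smul, map_smul, hv.proj_eq]
      split_ifs
      · rw [TensorProduct.lid_tmul, map_smul, rescale_apply _ hv]
      · simp))
    (tensor_ext (V := unit ω) fun a b r v hr hv => by
      simp [rescale_apply _ hv, smul_smul, TensorProduct.smul_tmul'])
    (hom_ext fun a v hv => by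
      simp [rescale_apply _ hv, smul_smul])

/-- The right unit isomorphism: `v ⊗ r ↦ ω a 1 1 • r • v` for `v` of degree `a`. -/
noncomputable def rightUnitIso (V : TwistedVect ω) : tensor V (unit ω) ≅ V :=
  isoOfLin (V := tensor V (unit ω)) (W := V)
    (rescale V (fun a => (ω a 1 1 : k)) ∘ₗ (TensorProduct.rid k V.carrier).toLinearMap)
    ((TensorProduct.rid k V.carrier).symm.toLinearMap ∘ₗ
      rescale V (fun a => ((ω a 1 1)⁻¹ : kˣ).val))
    (comm_of_comp (by
      classical
      intro d
      refine tensor_ext (W := unit ω) fun b a v r hv hr => ?_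
      change rescale V _ (TensorProduct.rid k V.carrier
          ((tensor V (unit ω)).proj d (v ⊗ₜ[k] r))) =
        V.proj d (rescale V _ (TensorProduct.rid k V.carrier (v ⊗ₜ[k] r)))
      have hr : IsHomog (V := unit ω) 1 r := isHomog_unit r
      have hp : (tensor V (unit ω)).proj d (v ⊗ₜ[k] r) = if d = b then v ⊗ₜ[k] r else 0 := by
        have := (hv.tmul hr).proj_eq d
        rwa [mul_one] at this
      rw [hp, TensorProduct.rid_tmul, map_smul, rescale_apply _ hv, map_smul, map_smul, hv.proj_eq]
      split_ifs
      · rw [TensorProduct.rid_tmul, map_smul, rescale_apply _ hv]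
      · simp))
    (tensor_ext (W := unit ω) fun b a v r hv hr => by
      simp only [LinearMap.comp_apply, LinearEquiv.coe_coe, TensorProduct.rid_tmul, map_smul,
        rescale_apply _ hv, TensorProduct.rid_symm_apply, LinearMap.id_apply]
      rw [smul_smul, smul_smul, mul_assoc, Units.mul_inv, mul_one, ← TensorProduct.tmul_smul, smul_eq_mul, mul_one])
    (hom_ext fun a v hv => by
      simp [rescale_apply _ hv, smul_smul])

noncomputable instance : MonoidalCategoryStruct (TwistedVect ω) where
  tensorObj V W := tensor V W
  whiskerLeft V _ _ f := tensorMap (𝟙 V) f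
  whiskerRight f W := tensorMap f (𝟙 W)
  tensorHom f g := tensorMap f g
  tensorUnit := unit ω
  associator := assocIso
  leftUnitor := leftUnitIso
  rightUnitor := rightUnitIso

noncomputable instance : MonoidalCategory (TwistedVect ω) where
  tensorHom_def f g := toLin_injective (TensorProduct.ext' fun v w => rfl)
  id_tensorHom_id V W := toLin_injective (TensorProduct.ext' fun v w => rfl)
  tensorHom_comp_tensorHom f g f' g' := toLin_injective (TensorProduct.ext' fun v w => rfl)
  whiskerLeft_id V W := toLin_injective (TensorProduct.ext' fun v w => rfl)
  id_whiskerRight V W := toLin_injective (TensorProduct.ext' fun v w => rfl)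
  associator_naturality {X₁ X₂ X₃ Y₁ Y₂ Y₃} f g h := toLin_injective (by
    refine tensor_ext₃ fun a b c v w x hv hw hx => ?_
    change assocLin Y₁ Y₂ Y₃ ((toLin f v ⊗ₜ toLin g w) ⊗ₜ toLin h x) =
      TensorProduct.map (toLin f) (TensorProduct.map (toLin g) (toLin h))
        (assocLin X₁ X₂ X₃ ((v ⊗ₜ w) ⊗ₜ x))
    rw [assocLin_apply hv hw hx, assocLin_apply (hv.toLin f) (hw.toLin g) (hx.toLin h)]
    simp)
  leftUnitor_naturality {V W} f := toLin_injective (by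
    refine tensor_ext (V := unit ω) fun a b r v hr hv => ?_
    change rescale W _ (TensorProduct.lid k W.carrier (r ⊗ₜ toLin f v)) =
      toLin f (rescale V _ (TensorProduct.lid k V.carrier (r ⊗ₜ v)))
    simp only [TensorProduct.lid_tmul, map_smul, rescale_apply _ hv,
      rescale_apply _ (hv.toLin f)])
  rightUnitor_naturality {V W} f := toLin_injective (by
    refine tensor_ext (W := unit ω) fun b a v r hv hr => ?_
    change rescale W _ (TensorProduct.rid k W.carrier (toLin f v ⊗ₜ r)) =
      toLin f (rescale V _ (TensorProduct.rid k V.carrier (v ⊗ₜ r)))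
    simp only [TensorProduct.rid_tmul, map_smul, rescale_apply _ hv,
      rescale_apply _ (hv.toLin f)])
  pentagon W X Y Z := toLin_injective (by
    refine tensor_ext₄ fun a b c d w x y z hw hx hy hz => ?_
    change TensorProduct.map LinearMap.id (assocLin X Y Z) (assocLin W (tensor X Y) Z
        (TensorProduct.map (assocLin W X Y) LinearMap.id (((w ⊗ₜ x) ⊗ₜ y) ⊗ₜ z))) =
      assocLin W X (tensor Y Z) (assocLin (tensor W X) Y Z (((w ⊗ₜ x) ⊗ₜ y) ⊗ₜ z))
    have key : (ω a b c : k) * ω a (b * c) d * ω b c d = ω (a * b) c d * ω a b (c * d) := by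
      exact_mod_cast congrArg Units.val (ω.cocycle a b c d)
    rw [TensorProduct.map_tmul, assocLin_apply hw hx hy, ← TensorProduct.smul_tmul', map_smul,
      LinearMap.id_apply,
      assocLin_apply (W := tensor X Y) hw (hx.tmul hy) hz, map_smul, map_smul,
      TensorProduct.map_tmul, assocLin_apply hx hy hz,
      assocLin_apply (V := tensor W X) (hw.tmul hx) hy hz, map_smul,
      assocLin_apply (X := tensor Y Z) hw hx (hy.tmul hz), smul_smul, TensorProduct.tmul_smul,
      smul_smul, smul_smul, key]
    rfl)
  triangle V W := toLin_injective (by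
    refine tensor_ext₃ (W := unit ω) fun a b c v r w hv hr hw => ?_
    have hr : IsHomog (V := unit ω) 1 r := isHomog_unit r
    change TensorProduct.map LinearMap.id (rescale W _ ∘ₗ (TensorProduct.lid k W.carrier).toLinearMap)
      (assocLin V (unit ω) W ((v ⊗ₜ r) ⊗ₜ w)) =
      (rescale V _ (TensorProduct.rid k V.carrier (v ⊗ₜ r))) ⊗ₜ w
    rw [assocLin_apply hv hr hw, ω.mid]
    simp [rescale_apply _ hv, rescale_apply _ hw, TensorProduct.smul_tmul', smul_smul]
    congr 2
    have h0 : (ω 1 1 c : k) ≠ 0 := Units.ne_zero _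
    have h1 : ∀ s y z : k, z ≠ 0 → s * z⁻¹ * (y * z) = s * y := by
      intro s y z hz; field_simp
    exact h1 _ _ _ h0)

end TwistedVect

section FusionCategories

attribute [local instance] Abelian.hasFiniteBiproducts

section Simples

variable (C : Type v) [Category.{w} C] [HasZeroMorphisms C]

/-- Isomorphism of simple objects. -/
def simpleSetoid : Setoid {X : C // Simple X} where
  r X Y := Nonempty (X.1 ≅ Y.1)
  iseqv := ⟨fun X => ⟨Iso.refl X.1⟩, fun ⟨e⟩ => ⟨e.symm⟩, fun ⟨e⟩ ⟨e'⟩ => ⟨e.trans e'⟩⟩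

/-- `Irr(C)`: the set of isomorphism classes of simple objects. -/
def Irr : Type v := Quotient (simpleSetoid C)

variable {C}

/-- A chosen simple object in an isomorphism class. -/
noncomputable def Irr.rep (x : Irr C) : C := (Quotient.out x).1

end Simples

/-- A fusion category over `k`: a `k`-linear semisimple rigid tensor category with finitely many
isomorphism classes of simple objects, finite-dimensional spaces of morphisms and simple unit. -/
class IsFusionCategory (k : Type u) [Field k] (C : Type v) [Category.{w} C] [Abelian C]
    [Linear k C] [MonoidalCategory C] [MonoidalPreadditive C] [MonoidalLinear k C]
    [RigidCategory C] : Prop where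
  finiteDimensional_hom : ∀ X Y : C, FiniteDimensional k (X ⟶ Y)
  semisimple : ∀ X : C, ∃ (n : ℕ) (S : Fin n → C), (∀ i, Simple (S i)) ∧ Nonempty (X ≅ ⨁ S)
  finite_irr : Finite (Irr C)
  simple_unit : Simple (𝟙_ C)

section

variable (C : Type v) [Category.{w} C] [Abelian C] [MonoidalCategory C] [RigidCategory C]

variable {C} in
/-- An object is invertible if `X ⊗ X* ≅ 𝟙`. -/
def IsInvertibleObj (X : C) : Prop := Nonempty (X ⊗ Xᘁ ≅ 𝟙_ C)

/-- A fusion category is pointed if all its simple objects are invertible. -/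
def IsPointed : Prop := ∀ X : C, Simple X → IsInvertibleObj X

/-- `G(C)`: the group of isomorphism classes of invertible objects, i.e. the group of units of the
monoid of isomorphism classes of objects under `⊗`. -/
abbrev InvertibleGroup : Type v := (Skeleton C)ˣ

/-- A generalized Tambara–Yamagami category: not pointed, and the tensor product of any two
non-invertible simple objects is a direct sum of invertible objects. -/
def IsGeneralizedTambaraYamagami : Prop :=
  ¬ IsPointed C ∧ ∀ X Y : C, Simple X → Simple Y → ¬ IsInvertibleObj X → ¬ IsInvertibleObj Y →
    ∃ (n : ℕ) (S : Fin n → C), (∀ i, IsInvertibleObj (S i)) ∧ Nonempty (X ⊗ Y ≅ ⨁ S)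

variable {C} in
/-- Fusion subcategories: full subcategories containing the unit and closed under tensor products,
duals, finite direct sums and direct summands (in particular under isomorphisms). -/
structure IsFusionSubcategory (P : ObjectProperty C) : Prop where
  unit : P (𝟙_ C)
  tensor : ∀ X Y : C, P X → P Y → P (X ⊗ Y)
  rightDual : ∀ X : C, P X → P (Xᘁ)
  leftDual : ∀ X : C, P X → P (ᘁX)
  biprod : ∀ X Y : C, P X → P Y → P (X ⊞ Y)
  summand : ∀ X Y : C, P X → Nonempty (Retract Y X) → P Y

/-- `C_ad`: the smallest fusion subcategory containing (the simple summands of) `X ⊗ X*` for all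
simple objects `X`. -/
def adjointSubcategory : ObjectProperty C := fun Y =>
  ∀ P : ObjectProperty C, IsFusionSubcategory P → (∀ X : C, Simple X → P (X ⊗ Xᘁ)) → P Y

end

section UniversalGrading

variable (C : Type v) [Category.{w} C] [Abelian C] [MonoidalCategory C]

/-- The relations `x y = z` for all simple `x`, `y` and all simple constituents `z` of `x ⊗ y`. -/
def gradingRelations : Set (FreeGroup (Irr C)) :=
  {r | ∃ x y z : Irr C, (∃ f : z.rep ⟶ x.rep ⊗ y.rep, f ≠ 0) ∧
    r = FreeGroup.of x * FreeGroup.of y * (FreeGroup.of z)⁻¹}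

/-- The universal grading group `U(C)`: generated by the degrees of the simple objects, subject
only to the relations that hold in every grading of `C`. So every grading of `C` by a group `H`
comes from a unique homomorphism `U(C) → H`. -/
abbrev UniversalGradingGroup : Type v := PresentedGroup (gradingRelations C)

/-- The component of degree `u` of the universal grading: the objects all of whose simple
constituents have degree `u`. -/
def universalComponent (u : UniversalGradingGroup C) : ObjectProperty C := fun X =>
  ∀ z : Irr C, (∃ f : z.rep ⟶ X, f ≠ 0) → PresentedGroup.of z = u

end UniversalGrading

section FrobeniusPerron

variable (k : Type u) [Field k] (C : Type v) [Category.{w} C] [Abelian C] [Linear k C]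
  [MonoidalCategory C]

variable {C} in
/-- The matrix of left multiplication by the class of `X` in the basis `Irr(C)` of the
Grothendieck ring; the multiplicity of a simple `z` in `X ⊗ y` is `dim Hom(z, X ⊗ y)`. -/
noncomputable def fusionMatrix (X : C) : Matrix (Irr C) (Irr C) ℝ := fun z y =>
  (Module.finrank k (z.rep ⟶ X ⊗ y.rep) : ℝ)

variable {C} in
/-- The Frobenius–Perron dimension of `X`: the Frobenius–Perron (i.e. largest real) eigenvalue of
the matrix of left multiplication by `X` (a square matrix indexed by the finite set `Irr(C)`). -/
noncomputable def FPdim (X : C) : ℝ :=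
  sSup {r : ℝ | ∃ v : Irr C → ℝ, v ≠ 0 ∧
    ∀ z : Irr C, ∑ᶠ y : Irr C, fusionMatrix k X z y * v y = r * v z}

/-- `C` is of type `(d₀,n₀; d₁,n₁; …; d_s,n_s)`, where `1 = d₀ < d₁ < ⋯ < d_s` and `n_i ≥ 1`:
the Frobenius–Perron dimensions of the simple objects are the `d_i`, and there are exactly `n_i`
isomorphism classes of simple objects of dimension `d_i`. -/
structure IsOfType {s : ℕ} (d : Fin (s + 1) → ℝ) (n : Fin (s + 1) → ℕ) : Prop where
  zero : d 0 = 1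
  strictMono : StrictMono d
  pos : ∀ i, 0 < n i
  card : ∀ i, Nat.card {x : Irr C // FPdim k x.rep = d i} = n i
  exhaust : ∀ x : Irr C, ∃ i, FPdim k x.rep = d i

end FrobeniusPerron

/-- A grading of a fusion category by a finite group `G`: a decomposition of `C` into a direct sum
of full replete subcategories `C_g` with `C_g ⊗ C_h ⊆ C_{gh}` and `(C_g)* = C_{g⁻¹}`. (The direct
sum decomposition forces every `C_g` to be closed under subobjects, quotients and finite direct
sums, so it is an abelian subcategory.) -/
structure FusionGrading (G : Type t) [Group G] [Finite G] (C : Type v) [Category.{w} C] [Abelian C]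
    [MonoidalCategory C] [RigidCategory C] where
  component : G → ObjectProperty C
  of_iso : ∀ (g : G) (X Y : C), (X ≅ Y) → component g X → component g Y
  decomposition : ∀ X : C, ∃ Y : G → C, (∀ g, component g (Y g)) ∧ Nonempty (X ≅ ⨁ Y)
  hom_eq_zero : ∀ (g h : G), g ≠ h → ∀ (X Y : C), component g X → component h Y →
    ∀ f : X ⟶ Y, f = 0
  tensor : ∀ (g h : G) (X Y : C), component g X → component h Y → component (g * h) (X ⊗ Y)
  dual : ∀ (g : G) (X : C), component g X ↔ component g⁻¹ (Xᘁ)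

namespace FusionGrading

variable {G : Type t} [Group G] [Finite G] {C : Type v} [Category.{w} C] [Abelian C]
  [MonoidalCategory C] [RigidCategory C] (𝒢 : FusionGrading G C)

/-- A grading is faithful if every component is nonzero. -/
def IsFaithful : Prop := ∀ g : G, ∃ X : C, 𝒢.component g X ∧ ¬ IsZero X

theorem unit_mem (h1 : Simple (𝟙_ C)) : 𝒢.component 1 (𝟙_ C) := by
  classical
  obtain ⟨Y, hY, ⟨e⟩⟩ := 𝒢.decomposition (𝟙_ C)
  have hne : ∃ g, biproduct.ι Y g ≫ e.inv ≠ 0 := by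
    by_contra hcon
    push Not at hcon
    have : e.inv = 0 := biproduct.hom_ext' _ _ fun g => by rw [hcon g, comp_zero]
    exact id_nonzero (𝟙_ C) (by rw [← e.hom_inv_id, this, comp_zero])
  obtain ⟨g, hg⟩ := hne
  have : IsIso (biproduct.ι Y g ≫ e.inv) := isIso_of_mono_of_nonzero hg
  have hgu : 𝒢.component g (𝟙_ C) :=
    𝒢.of_iso g _ _ (asIso (biproduct.ι Y g ≫ e.inv)) (hY g)
  have hgg : 𝒢.component (g * g) (𝟙_ C) :=
    𝒢.of_iso _ _ _ (λ_ (𝟙_ C)) (𝒢.tensor g g _ _ hgu hgu)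
  have : g * g = g := by
    by_contra hcon
    exact id_nonzero (𝟙_ C) (𝒢.hom_eq_zero _ _ hcon _ _ hgg hgu _)
  rw [mul_eq_left] at this
  rwa [this] at hgu

theorem isMonoidal (h1 : Simple (𝟙_ C)) : (𝒢.component 1).IsMonoidal where
  prop_unit := 𝒢.unit_mem h1
  prop_tensor X Y hX hY := by simpa using 𝒢.tensor 1 1 X Y hX hY

end FusionGrading

/-- Equivalence of `k`-linear monoidal categories. -/
def TensorEquivalent (k : Type u) [Field k] (D : Type*) [Category* D] [Preadditive D] [Linear k D]
    [MonoidalCategory D] (E : Type*) [Category* E] [Preadditive E] [Linear k E]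
    [MonoidalCategory E] : Prop :=
  ∃ F : D ⥤ E, F.IsEquivalence ∧ F.Additive ∧ F.Linear k ∧ Nonempty F.Monoidal

/-- The grading `𝒢` makes `C` a `G`-extension of `D`: it is faithful and its trivial component is
equivalent to `D`. -/
def FusionGrading.IsExtensionOf {G : Type t} [Group G] [Finite G] {C : Type v} [Category.{w} C]
    [Abelian C] [MonoidalCategory C] [RigidCategory C] (𝒢 : FusionGrading G C)
    (k : Type u) [Field k] [Linear k C] [MonoidalPreadditive C] [MonoidalLinear k C]
    [IsFusionCategory k C]
    (D : Type*) [Category* D] [Preadditive D] [Linear k D] [MonoidalCategory D] : Prop :=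
  haveI := 𝒢.isMonoidal (IsFusionCategory.simple_unit k)
  𝒢.IsFaithful ∧ TensorEquivalent k D (𝒢.component 1).FullSubcategory

end FusionCategories

-- The trivial component has two simple objects, `𝟙` and `δ`, with `δ ⊗ δ ≅ 𝟙`. For a simple `X`,
-- the object `X ⊗ Xᘁ` lies in the trivial component; it contains `𝟙` once and contains `δ` with
-- multiplicity `dim Hom(δ ⊗ X, X)`, which is 0 or 1. So `X` is invertible exactly when `δ` does not
-- fix it (`isInvertibleObj_iff`). A simple object fixed by `δ` is a rank one module over `Vec^ω`:
-- its action isomorphisms multiply up to scalars, and these scalars form a cochain with coboundary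
-- `ω` (`ThreeCocycle.isTrivial_of_fixed`). Hence a nontrivial class forces `C` to be pointed.
--
-- Two simple objects of one component differ by `𝟙` or `δ` (`eq_or_eq_mul_right`), so a component
-- contains either two invertible objects or one non-invertible simple object. For non-invertible
-- simple `X`, `Y` the space `End(X ⊗ Y)` has dimension 2, so `X ⊗ Y` has two non-isomorphic simple
-- summands in one component, which are therefore invertible (`tensor_of_not_isUnit`). This is the
-- generalized Tambara–Yamagami property, and it makes `1` on invertible and `√2` on non-invertible
-- simple objects a positive multiplicative dimension, hence `FPdim` by a Perron–Frobenius argument.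
--
-- Multiplication by the degree of a non-invertible simple object exchanges the degrees carrying
-- invertible objects with the others (`ncard_compl_invertibleDegrees`); this gives the numbers
-- `2n`, `n` and `|G| = 2n`. Finally `δ ⊗ X ≅ X` forces `δ` to have degree 1 in every grading, so
-- `U(C) → G` is injective (`universalHom_bijective`), and `δ` is a summand of `X ⊗ Xᘁ`, so the
-- trivial component is adjoint.

attribute [local instance] Abelian.hasFiniteBiproducts

/-! ### Dimensions of Hom spaces. -/

section HomDimension

variable (k : Type u) [Field k] {C : Type v} [Category.{w} C] [Abelian C] [Linear k C]

/-- Morphisms into a finite biproduct are families of morphisms. -/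
noncomputable def homBiproductEquiv {J : Type*} [Finite J] (X : C) (S : J → C) :
    (X ⟶ ⨁ S) ≃ₗ[k] ∀ j, (X ⟶ S j) where
  toFun f j := f ≫ biproduct.π S j
  invFun f := biproduct.lift f
  map_add' f g := by ext; simp
  map_smul' c f := by ext; simp
  left_inv f := by ext; simp
  right_inv f := by ext; simp

/-- Morphisms out of a finite biproduct are families of morphisms. -/
noncomputable def biproductHomEquiv {J : Type*} [Finite J] (S : J → C) (X : C) :
    ((⨁ S) ⟶ X) ≃ₗ[k] ∀ j, (S j ⟶ X) where
  toFun f j := biproduct.ι S j ≫ f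
  invFun f := biproduct.desc f
  map_add' f g := by ext; simp
  map_smul' c f := by ext; simp
  left_inv f := by ext; simp
  right_inv f := by ext; simp

theorem finrank_hom_congr {X X' Y Y' : C} (e : X ≅ X') (e' : Y ≅ Y') :
    Module.finrank k (X ⟶ Y) = Module.finrank k (X' ⟶ Y') :=
  (Linear.homCongr k e e').finrank_eq

variable [hfd : ∀ X Y : C, FiniteDimensional k (X ⟶ Y)]

theorem finrank_hom_biproduct {J : Type*} [Fintype J] (X : C) (S : J → C) :
    Module.finrank k (X ⟶ ⨁ S) = ∑ j, Module.finrank k (X ⟶ S j) := by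
  rw [(homBiproductEquiv k X S).finrank_eq, Module.finrank_pi_fintype]

theorem finrank_biproduct_hom {J : Type*} [Fintype J] (S : J → C) (X : C) :
    Module.finrank k ((⨁ S) ⟶ X) = ∑ j, Module.finrank k (S j ⟶ X) := by
  rw [(biproductHomEquiv k S X).finrank_eq, Module.finrank_pi_fintype]

theorem finrank_hom_pos_iff {X Y : C} :
    0 < Module.finrank k (X ⟶ Y) ↔ ∃ f : X ⟶ Y, f ≠ 0 := by
  rw [Module.finrank_pos_iff_exists_ne_zero]

variable [IsAlgClosed k]

open Classical in
-- Schur's lemma, phrased with classes in the skeleton so that isomorphisms between tensor products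
-- become equations in a monoid.
theorem finrank_hom_simple (X Y : C) [Simple X] [Simple Y] :
    Module.finrank k (X ⟶ Y) = if toSkeleton X = toSkeleton Y then 1 else 0 := by
  rw [finrank_hom_simple_simple, toSkeleton_eq_toSkeleton_iff]

end HomDimension

/-! ### Linear form of the duality adjunctions. -/

section Duality

variable (k : Type u) [Field k] {C : Type v} [Category.{w} C] [Abelian C] [Linear k C]
  [MonoidalCategory C] [MonoidalPreadditive C] [MonoidalLinear k C]

theorem finrank_tensorLeft_hom (X Y Y' Z : C) [ExactPairing Y Y'] :
    Module.finrank k (Y' ⊗ X ⟶ Z) = Module.finrank k (X ⟶ Y ⊗ Z) :=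
  LinearEquiv.finrank_eq
    { tensorLeftHomEquiv X Y Y' Z with
      map_add' := fun f g => by simp [tensorLeftHomEquiv, MonoidalPreadditive.whiskerLeft_add]
      map_smul' := fun c f => by simp [tensorLeftHomEquiv, MonoidalLinear.whiskerLeft_smul] }

theorem finrank_tensorRight_hom (X Y Y' Z : C) [ExactPairing Y Y'] :
    Module.finrank k (X ⊗ Y ⟶ Z) = Module.finrank k (X ⟶ Z ⊗ Y') :=
  LinearEquiv.finrank_eq
    { tensorRightHomEquiv X Y Y' Z with
      map_add' := fun f g => by simp [tensorRightHomEquiv, MonoidalPreadditive.add_whiskerRight]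
      map_smul' := fun c f => by simp [tensorRightHomEquiv, MonoidalLinear.smul_whiskerRight] }

end Duality

/-! ### Invertible objects as units of the monoid of isomorphism classes. -/

section Units

variable {C : Type v} [Category.{w} C] [MonoidalCategory C]

/-- A unit has a two-sided inverse, whereas `IsInvertibleObj` asks for `X ⊗ Xᘁ ≅ 𝟙` only; for simple
objects of the extension the two are reconciled in `isInvertibleObj_iff_isUnit`. -/
theorem isUnit_toSkeleton_iff (X : C) : IsUnit (toSkeleton X) ↔
    ∃ Y : C, Nonempty (X ⊗ Y ≅ 𝟙_ C) ∧ Nonempty (Y ⊗ X ≅ 𝟙_ C) := by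
  rw [isUnit_iff_exists]
  constructor
  · rintro ⟨s, h1, h2⟩
    obtain ⟨Y, rfl⟩ := Quotient.exists_rep s
    change toSkeleton X * toSkeleton Y = _ at h1
    change toSkeleton Y * toSkeleton X = _ at h2
    rw [← Skeleton.toSkeleton_tensorObj, Skeleton.one_eq, toSkeleton_eq_toSkeleton_iff] at h1 h2
    exact ⟨Y, h1, h2⟩
  · rintro ⟨Y, ⟨e1⟩, ⟨e2⟩⟩
    refine ⟨toSkeleton Y, ?_, ?_⟩
    · rw [← Skeleton.toSkeleton_tensorObj, Skeleton.one_eq]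
      exact congr_toSkeleton_of_iso e1
    · rw [← Skeleton.toSkeleton_tensorObj, Skeleton.one_eq]
      exact congr_toSkeleton_of_iso e2

theorem isEquivalence_tensorLeft {X : C} (h : IsUnit (toSkeleton X)) :
    (tensorLeft X).IsEquivalence := by
  obtain ⟨Y, ⟨e1⟩, ⟨e2⟩⟩ := (isUnit_toSkeleton_iff X).1 h
  exact (CategoryTheory.Equivalence.mk (tensorLeft X) (tensorLeft Y)
    ((leftUnitorNatIso C).symm ≪≫ (tensoringLeft C).mapIso e2.symm ≪≫ tensorLeftTensor Y X)
    ((tensorLeftTensor X Y).symm ≪≫ (tensoringLeft C).mapIso e1 ≪≫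
      leftUnitorNatIso C)).isEquivalence_functor

theorem isEquivalence_tensorRight {X : C} (h : IsUnit (toSkeleton X)) :
    (tensorRight X).IsEquivalence := by
  obtain ⟨Y, ⟨e1⟩, ⟨e2⟩⟩ := (isUnit_toSkeleton_iff X).1 h
  exact (CategoryTheory.Equivalence.mk (tensorRight X) (tensorRight Y)
    ((rightUnitorNatIso C).symm ≪≫ (tensoringRight C).mapIso e1.symm ≪≫ tensorRightTensor X Y)
    ((tensorRightTensor Y X).symm ≪≫ (tensoringRight C).mapIso e2 ≪≫
      rightUnitorNatIso C)).isEquivalence_functor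

variable [HasZeroMorphisms C]

theorem simple_tensor_of_isUnit_left {X : C} (h : IsUnit (toSkeleton X)) (Y : C) [Simple Y] :
    Simple (X ⊗ Y) :=
  have := isEquivalence_tensorLeft h
  simple_obj (tensorLeft X) Y

theorem simple_tensor_of_isUnit_right {X : C} (h : IsUnit (toSkeleton X)) (Y : C) [Simple Y] :
    Simple (Y ⊗ X) :=
  have := isEquivalence_tensorRight h
  simple_obj (tensorRight X) Y

theorem simple_of_isUnit {X : C} (h : IsUnit (toSkeleton X)) [Simple (𝟙_ C)] : Simple X :=
  have := simple_tensor_of_isUnit_left h (𝟙_ C)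
  Simple.of_iso (ρ_ X).symm

end Units

/-! ### Nonzero objects, duals and tensor products. -/

section Fusion

variable {C : Type v} [Category.{w} C] [Abelian C] [MonoidalCategory C]

theorem exists_simple_hom_ne_zero (k : Type u) [Field k] [Linear k C] [MonoidalPreadditive C]
    [MonoidalLinear k C] [RigidCategory C] [IsFusionCategory k C] {X : C} (hX : ¬ IsZero X) :
    ∃ S : C, Simple S ∧ ∃ f : S ⟶ X, f ≠ 0 := by
  obtain ⟨n, S, hS, ⟨e⟩⟩ := IsFusionCategory.semisimple k X
  by_contra! h
  have h0 : e.inv = 0 := biproduct.hom_ext' _ _ fun j =>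
    (h (S j) (hS j) _).trans comp_zero.symm
  exact hX ((IsZero.iff_id_eq_zero _).2 (by rw [← e.hom_inv_id, h0, comp_zero]))

variable [MonoidalPreadditive C]

/-- By a zigzag identity, `𝟙 X` factors through the coevaluation up to unitors. -/
theorem coevaluation_ne_zero {X Y : C} [ExactPairing X Y] (hX : ¬ IsZero X) :
    η_ X Y ≠ 0 := by
  intro h
  refine hX ((IsZero.iff_id_eq_zero _).2 ?_)
  have := ExactPairing.evaluation_coevaluation X Y
  rw [h, MonoidalPreadditive.zero_whiskerRight, zero_comp] at this
  rw [← cancel_epi (λ_ X).hom, ← cancel_mono (ρ_ X).inv]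
  simpa using this.symm

theorem not_isZero_of_exactPairing {X Y : C} [ExactPairing X Y] (hY : ¬ IsZero Y) :
    ¬ IsZero X := by
  intro hX
  refine hY ((IsZero.iff_id_eq_zero _).2 ?_)
  have h : η_ X Y = 0 :=
    ((tensorRight Y).map_isZero hX).eq_of_tgt _ _
  have := ExactPairing.coevaluation_evaluation X Y
  rw [h, MonoidalPreadditive.whiskerLeft_zero, zero_comp] at this
  rw [← cancel_epi (ρ_ Y).hom, ← cancel_mono (λ_ Y).inv]
  simpa using this.symm

/-- The unit is simple, so the coevaluation `𝟙 ⟶ ᘁX ⊗ X` is a monomorphism. Tensoring with `Y` is a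
right adjoint and preserves it, so `Y` embeds into `ᘁX ⊗ X ⊗ Y`. -/
theorem not_isZero_tensor [RigidCategory C] [Simple (𝟙_ C)] {X Y : C} (hX : ¬ IsZero X) (hY : ¬ IsZero Y) :
    ¬ IsZero (X ⊗ Y) := by
  intro h
  have hne : η_ (ᘁX : C) X ≠ 0 := coevaluation_ne_zero (not_isZero_of_exactPairing (Y := X) hX)
  have : Mono (η_ (ᘁX : C) X) := mono_of_nonzero_from_simple hne
  have : (tensorRight Y).IsRightAdjoint := (tensorRightAdjunction (ᘁY : C) Y).isRightAdjoint
  have hm : Mono ((tensorRight Y).map (η_ (ᘁX : C) X)) := inferInstance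
  have hz : IsZero (((ᘁX : C) ⊗ X) ⊗ Y) :=
    ((tensorLeft (ᘁX : C)).map_isZero h).of_iso (α_ _ _ _)
  have hz' : IsZero (𝟙_ C ⊗ Y) := IsZero.of_mono ((tensorRight Y).map (η_ (ᘁX : C) X)) hz
  exact hY (hz'.of_iso (λ_ Y).symm)

end Fusion

/-! ### Representatives of simple objects. -/

section IrrBasics

variable {C : Type v} [Category.{w} C] [HasZeroMorphisms C]

instance Irr.simple_rep (x : Irr C) : Simple x.rep := (Quotient.out x).2

theorem Irr.exists_rep_iso (X : C) [Simple X] : ∃ x : Irr C, Nonempty (x.rep ≅ X) := by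
  refine ⟨Quotient.mk (simpleSetoid C) ⟨X, inferInstance⟩, ?_⟩
  exact Quotient.mk_out (s := simpleSetoid C) ⟨X, inferInstance⟩

theorem Irr.eq_iff {x y : Irr C} : x = y ↔ toSkeleton x.rep = toSkeleton y.rep := by
  rw [toSkeleton_eq_toSkeleton_iff]
  exact Quotient.out_equiv_out (s := simpleSetoid C).symm

end IrrBasics

/-! ### One-dimensional objects of `Vec_Γ^ω`. -/

namespace TwistedVect

variable {Γ : Type v} [Group Γ] [Fintype Γ] {k : Type u} [Field k] {ω : ThreeCocycle Γ k}

open Classical in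
/-- The one-dimensional object of degree `a`. -/
noncomputable abbrev line (ω : ThreeCocycle Γ k) (a : Γ) : TwistedVect ω where
  carrier := k
  proj b := if b = a then 1 else 0
  isComplete := by
    rw [CompleteOrthogonalIdempotents.iff_ortho_complete]
    constructor
    · intro b c hbc
      by_cases hb : b = a
      · have hc : ¬ c = a := fun h => hbc (hb.trans h.symm)
        simp [hc]
      · simp [hb]
    · simp

theorem isHomog_line (a : Γ) (c : k) : IsHomog (V := line ω a) a c := by
  simp only [IsHomog, line, if_true]
  rfl

/-- The multiplication `line a ⊗ line b ⟶ line c`, where `a * b = c`. -/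
noncomputable def lineMul {a b c : Γ} (h : a * b = c) :
    line ω a ⊗ line ω b ≅ line ω c :=
  isoOfLin (V := tensor (line ω a) (line ω b)) (W := line ω c)
    (TensorProduct.lid k k).toLinearMap (TensorProduct.lid k k).symm.toLinearMap
    (comm_of_comp (V := tensor (line ω a) (line ω b)) (W := line ω c) (by
      classical
      intro d
      refine tensor_ext (V := line ω a) (W := line ω b) (M := k) fun a' b' v w _ _ => ?_
      have hv := isHomog_line (ω := ω) a v
      have hw := isHomog_line (ω := ω) b w
      have h1 := tensorProj_apply hv hw d
      have h2 := (isHomog_line (ω := ω) c (TensorProduct.lid k k (v ⊗ₜ w))).proj_eq d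
      refine (congrArg (TensorProduct.lid k k) h1).trans (Eq.trans ?_ h2.symm)
      rw [h]
      split_ifs
      · rfl
      · exact map_zero _))
    (LinearEquiv.symm_comp _) (LinearEquiv.comp_symm _)

/-- On underlying scalars both composites are multiplication in `k`; the factor `ω a b c` comes from
the associator alone. Products of degrees are passed as equations, which avoids transport between
`line ω (a * b * c)` and `line ω (a * (b * c))`. -/
theorem lineMul_assoc {a b c ab bc abc : Γ} (hab : a * b = ab) (hbc : b * c = bc)
    (h : ab * c = abc) (h' : a * bc = abc) :
    (ω a b c : k) • ((lineMul (ω := ω) hab).hom ▷ line ω c ≫ (lineMul h).hom) =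
      (α_ _ _ _).hom ≫ line ω a ◁ (lineMul hbc).hom ≫ (lineMul h').hom := by
  apply toLin_injective
  refine tensor_ext₃ (V := line ω a) (W := line ω b) (X := line ω c) fun a' b' c' v w x _ _ _ => ?_
  change (ω a b c : k) • TensorProduct.lid k k (TensorProduct.lid k k (v ⊗ₜ w) ⊗ₜ x) =
    TensorProduct.lid k k (TensorProduct.map LinearMap.id (TensorProduct.lid k k).toLinearMap
      (assocLin (line ω a) (line ω b) (line ω c) ((v ⊗ₜ w) ⊗ₜ x)))
  have := assocLin_apply (isHomog_line (ω := ω) a v) (isHomog_line b w) (isHomog_line c x)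
  rw [this, map_smul, map_smul]
  congr 1
  change (v * w) * x = v * (w * x)
  ring

/-- The unit object is the line of degree `1`. -/
noncomputable def lineOneIso (ω : ThreeCocycle Γ k) : 𝟙_ (TwistedVect ω) ≅ line ω 1 := Iso.refl _

theorem line_hom_eq_zero {a b : Γ} (hab : a ≠ b) (f : line ω a ⟶ line ω b) : f = 0 := by
  classical
  apply toLin_injective
  refine hom_ext fun c v _ => ?_
  have h1 : IsHomog a (toLin f v) := (isHomog_line a v).toLin f
  have h2 := (isHomog_line (ω := ω) b (toLin f v)).proj_eq a
  rw [if_neg hab] at h2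
  exact h1.symm.trans h2

theorem exists_line_hom_ne_zero (V : TwistedVect ω) (hV : 𝟙 V ≠ 0) :
    ∃ (a : Γ) (f : line ω a ⟶ V), f ≠ 0 := by
  have : ∃ (a : Γ) (v : V.carrier), IsHomog a v ∧ v ≠ 0 := by
    by_contra! h
    exact hV (toLin_injective (hom_ext fun a v hv => by rw [h a v hv, map_zero, map_zero]))
  obtain ⟨a, v, hv, hv0⟩ := this
  refine ⟨a, ofHomog (V := line ω a) (LinearMap.toSpanSingleton k V.carrier v) ?_, ?_⟩
  · classical
    intro b c hc
    by_cases hb : b = a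
    · subst hb
      exact hv.smul c
    · have : c = 0 := by
        have h2 := (isHomog_line (ω := ω) a c).proj_eq b
        rw [if_neg hb] at h2
        exact hc.symm.trans h2
      subst this
      simp only [IsHomog]
      erw [map_zero, map_zero]
  · intro h
    apply hv0
    have := DFunLike.congr_fun (congrArg toLin h) (1 : k)
    exact (one_smul k v).symm.trans this

end TwistedVect

/-! ### The cohomological obstruction to a fixed simple object. -/

section Cohomology

variable {k : Type u} [Field k] {C : Type v} [Category.{w} C] [Preadditive C] [Linear k C]
  [MonoidalCategory C] [MonoidalPreadditive C] [MonoidalLinear k C]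

/-- A simple object fixed by a family of objects `A a` which multiply as the lines of `Vec_Γ^ω`
trivializes `ω`. -/
theorem ThreeCocycle.isTrivial_of_fixed {Γ : Type t} [Group Γ] (ω : ThreeCocycle Γ k) (A : Γ → C)
    (m : ∀ {a b c : Γ}, a * b = c → (A a ⊗ A b ≅ A c))
    (hm : ∀ {a b c ab bc abc : Γ} (hab : a * b = ab) (hbc : b * c = bc) (h : ab * c = abc)
      (h' : a * bc = abc), (ω a b c : k) • ((m hab).hom ▷ A c ≫ (m h).hom) =
        (α_ _ _ _).hom ≫ A a ◁ (m hbc).hom ≫ (m h').hom)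
    (X : C) (hX : ∀ f : X ⟶ X, ∃ c : k, f = c • 𝟙 X) (hX0 : 𝟙 X ≠ 0)
    (φ : ∀ a, A a ⊗ X ≅ X) : ω.IsTrivial := by
  -- Both sides are isomorphisms onto `X`, whose endomorphisms are scalars, so they differ by a
  -- nonzero scalar. These scalars are the cochain `η`.
  have key : ∀ a b, ∃ c : kˣ, (m (a := a) (b := b) rfl).hom ▷ X ≫ (φ (a * b)).hom =
      (c : k) • ((α_ _ _ _).hom ≫ A a ◁ (φ b).hom ≫ (φ a).hom) := by
    intro a b
    let e : (A a ⊗ A b) ⊗ X ≅ X := α_ _ _ _ ≪≫ whiskerLeftIso (A a) (φ b) ≪≫ φ a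
    let e' : (A a ⊗ A b) ⊗ X ≅ X := whiskerRightIso (m (a := a) (b := b) rfl) X ≪≫ φ (a * b)
    obtain ⟨c, hc⟩ := hX (e.inv ≫ e'.hom)
    have h : e'.hom = c • e.hom := by
      rw [← cancel_epi e.inv, hc, Linear.comp_smul, e.inv_hom_id]
    have hc0 : c ≠ 0 := by
      rintro rfl
      rw [zero_smul] at h
      exact hX0 (by rw [← e'.inv_hom_id, h, comp_zero])
    exact ⟨Units.mk0 c hc0, h⟩
  choose η hη using key
  refine ⟨η, fun a b c => ?_⟩
  -- The product degree is left free so that the identity also applies to `a * (b * c) = a * b * c`,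
  -- which is not definitional.
  have hη' : ∀ {a b ab : Γ} (h : a * b = ab), (m h).hom ▷ X ≫ (φ ab).hom =
      (η a b : k) • ((α_ _ _ _).hom ≫ A a ◁ (φ b).hom ≫ (φ a).hom) := by
    rintro a b _ rfl
    exact hη a b
  -- The reference isomorphism letting `A c`, `A b`, `A a` act in turn; both ways of multiplying the
  -- three objects first are scalar multiples of it.
  let E : ((A a ⊗ A b) ⊗ A c) ⊗ X ≅ X :=
    α_ _ _ _ ≪≫ whiskerLeftIso (A a ⊗ A b) (φ c) ≪≫ α_ _ _ _ ≪≫ whiskerLeftIso (A a) (φ b) ≪≫ φ a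
  have h1 : ((m (a := a) (b := b) rfl).hom ▷ A c ≫ (m (a := a * b) (b := c) rfl).hom) ▷ X ≫
      (φ (a * b * c)).hom = ((η (a * b) c : k) * η a b) • E.hom := by
    rw [comp_whiskerRight, Category.assoc, hη', Linear.comp_smul]
    rw [associator_naturality_left_assoc, ← whisker_exchange_assoc, hη' rfl]
    simp [E, smul_smul]
  have h2 : ((α_ _ _ _).hom ≫ A a ◁ (m (a := b) (b := c) rfl).hom ≫
      (m (c := a * b * c) (mul_assoc a b c).symm).hom) ▷ X ≫
      (φ (a * b * c)).hom = ((η a (b * c) : k) * η b c) • E.hom := by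
    rw [comp_whiskerRight, comp_whiskerRight, Category.assoc, Category.assoc, hη',
      Linear.comp_smul, Linear.comp_smul, associator_naturality_middle_assoc,
      ← whiskerLeft_comp_assoc, hη' rfl]
    simp [E, smul_smul]
  -- Associativity up to `ω`, whiskered with `X`, compares the two multiples of `E`. Since `E` is
  -- nonzero the coefficients agree, which is the coboundary equation.
  rw [← hm rfl rfl rfl (mul_assoc a b c).symm, MonoidalLinear.smul_whiskerRight, Linear.smul_comp,
    h1, smul_smul] at h2
  have h3 : (ω a b c : k) * (η (a * b) c * η a b) = η a (b * c) * η b c := by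
    by_contra hne
    have hsub := sub_eq_zero.2 h2
    rw [← sub_smul, smul_eq_zero_iff_right (sub_ne_zero.2 hne)] at hsub
    exact hX0 (by rw [← E.inv_hom_id, hsub, comp_zero])
  have h4 : ω a b c * (η (a * b) c * η a b) = η a (b * c) * η b c := by
    ext
    exact_mod_cast h3
  rw [eq_mul_inv_of_mul_eq h4, mul_inv]
  simp only [mul_assoc, mul_comm, mul_left_comm]

end Cohomology

section Lines

open Functor.LaxMonoidal Functor.Monoidal in
/-- A linear monoidal functor carries the multiplication of lines to its target. -/
theorem TwistedVect.exists_lineMul_map {Γ : Type t} [Group Γ] [Fintype Γ] {k : Type u} [Field k]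
    {ω : ThreeCocycle Γ k} {C : Type v} [Category.{w} C] [Preadditive C] [Linear k C]
    [MonoidalCategory C] [MonoidalPreadditive C] [MonoidalLinear k C] (F : TwistedVect ω ⥤ C)
    [F.Monoidal] [F.Additive] [F.Linear k] :
    ∃ m : ∀ {a b c : Γ}, a * b = c → (F.obj (line ω a) ⊗ F.obj (line ω b) ≅ F.obj (line ω c)),
      ∀ {a b c ab bc abc : Γ} (hab : a * b = ab) (hbc : b * c = bc) (h : ab * c = abc)
        (h' : a * bc = abc), (ω a b c : k) • ((m hab).hom ▷ F.obj (line ω c) ≫ (m h).hom) =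
          (α_ _ _ _).hom ≫ F.obj (line ω a) ◁ (m hbc).hom ≫ (m h').hom := by
  refine ⟨fun h => μIso F _ _ ≪≫ F.mapIso (lineMul h), ?_⟩
  intro a b c ab bc abc hab hbc h h'
  have key := congrArg F.map (lineMul_assoc (ω := ω) hab hbc h h')
  simp only [F.map_smul, F.map_comp] at key
  simp only [Iso.trans_hom, μIso_hom, Functor.mapIso_hom, comp_whiskerRight, Category.assoc,
    μ_natural_left_assoc, MonoidalCategory.whiskerLeft_comp, μ_natural_right_assoc]
  rw [← associativity_assoc, ← key]
  simp only [Linear.comp_smul]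

end Lines

theorem finiteDimensional_hom_of_isFusionCategory (k : Type u) [Field k] {C : Type v}
    [Category.{w} C] [Abelian C] [Linear k C] [MonoidalCategory C] [MonoidalPreadditive C]
    [MonoidalLinear k C] [RigidCategory C] [IsFusionCategory k C] (X Y : C) :
    FiniteDimensional k (X ⟶ Y) :=
  IsFusionCategory.finiteDimensional_hom X Y

/-- By semisimplicity and Schur, both sides are the multiplicity of `S` in `X`. It supplies maps in
the direction required by the duality adjunctions. -/
theorem finrank_hom_simple_comm (k : Type u) [Field k] [IsAlgClosed k] {C : Type v}
    [Category.{w} C] [Abelian C] [Linear k C] [MonoidalCategory C] [MonoidalPreadditive C]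
    [MonoidalLinear k C] [RigidCategory C] [IsFusionCategory k C] (S X : C) [Simple S] :
    Module.finrank k (S ⟶ X) = Module.finrank k (X ⟶ S) := by
  classical
  have := finiteDimensional_hom_of_isFusionCategory k (C := C)
  obtain ⟨n, T, hT, ⟨e⟩⟩ := IsFusionCategory.semisimple k X
  rw [finrank_hom_congr k (Iso.refl S) e, finrank_hom_congr k e (Iso.refl S),
    finrank_hom_biproduct, finrank_biproduct_hom]
  refine Finset.sum_congr rfl fun i _ => ?_
  rw [finrank_hom_simple, finrank_hom_simple]
  simp only [eq_comm]

/-! ### Components of a grading. -/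

namespace FusionGrading

variable {G : Type t} [Group G] [Finite G] {C : Type v} [Category.{w} C] [Abelian C]
  [MonoidalCategory C] [RigidCategory C] (𝒢 : FusionGrading G C)

/-- A component is the orthogonal of all the others: if nothing maps into `X` from other degrees,
the remaining summands of its decomposition vanish. Closure under summands and sums then reduces to
vanishing of morphisms. -/
theorem component_iff_hom_eq_zero (g : G) (X : C) : 𝒢.component g X ↔
    ∀ h, h ≠ g → ∀ Y, 𝒢.component h Y → ∀ f : Y ⟶ X, f = 0 := by
  classical
  refine ⟨fun hX h hh Y hY f => 𝒢.hom_eq_zero h g hh Y X hY hX f, fun H => ?_⟩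
  obtain ⟨Y, hY, ⟨e⟩⟩ := 𝒢.decomposition X
  have hι : ∀ h, h ≠ g → biproduct.ι Y h = 0 := fun h hh => by
    have := H h hh _ (hY h) (biproduct.ι Y h ≫ e.inv)
    rwa [Preadditive.IsIso.comp_right_eq_zero] at this
  have hπ : biproduct.π Y g ≫ biproduct.ι Y g = 𝟙 _ := by
    refine biproduct.hom_ext' _ _ fun h => ?_
    by_cases hh : h = g
    · subst hh; simp
    · rw [hι h hh]; simp
  refine 𝒢.of_iso g (Y g) X ?_ (hY g)
  exact { hom := biproduct.ι Y g ≫ e.inv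
          inv := e.hom ≫ biproduct.π Y g
          hom_inv_id := by simp
          inv_hom_id := by
            rw [Category.assoc, reassoc_of% hπ, e.hom_inv_id] }

theorem component_of_retract {g : G} {X Y : C} (r : Retract Y X) (hX : 𝒢.component g X) :
    𝒢.component g Y := by
  rw [component_iff_hom_eq_zero] at hX ⊢
  intro h hh Z hZ f
  rw [← Category.comp_id f, ← r.retract, ← Category.assoc, hX h hh Z hZ (f ≫ r.i), zero_comp]

theorem component_biproduct {J : Type*} [Finite J] {g : G} {S : J → C}
    (hS : ∀ j, 𝒢.component g (S j)) : 𝒢.component g (⨁ S) := by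
  rw [component_iff_hom_eq_zero]
  intro h hh Z hZ f
  refine biproduct.hom_ext _ _ fun j => ?_
  exact (𝒢.hom_eq_zero h g hh Z _ hZ (hS j) _).trans zero_comp.symm

theorem component_biprod {g : G} {X Y : C} (hX : 𝒢.component g X) (hY : 𝒢.component g Y) :
    𝒢.component g (X ⊞ Y) := by
  rw [component_iff_hom_eq_zero]
  intro h hh Z hZ f
  refine biprod.hom_ext _ _ ?_ ?_
  · exact (𝒢.hom_eq_zero h g hh Z X hZ hX _).trans zero_comp.symm
  · exact (𝒢.hom_eq_zero h g hh Z Y hZ hY _).trans zero_comp.symm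

theorem component_leftDual {g : G} {X : C} (hX : 𝒢.component g X) :
    𝒢.component g⁻¹ (ᘁX : C) := by
  rw [𝒢.dual, inv_inv]
  exact 𝒢.of_iso g _ _ (rightDualIso (X := ᘁX) inferInstance inferInstance) hX

theorem component_unique {g h : G} {X : C} (hX : ¬ IsZero X) (hg : 𝒢.component g X)
    (hh : 𝒢.component h X) : g = h := by
  by_contra hne
  exact hX ((IsZero.iff_id_eq_zero X).2 (𝒢.hom_eq_zero g h hne X X hg hh _))

/-- The homogeneous summands of `X` embed in it, and a nonzero monomorphism into a simple object is
an isomorphism. -/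
theorem exists_component (X : C) [Simple X] : ∃ g, 𝒢.component g X := by
  obtain ⟨Y, hY, ⟨e⟩⟩ := 𝒢.decomposition X
  have hne : ∃ g, biproduct.ι Y g ≫ e.inv ≠ 0 := by
    by_contra! hcon
    have : e.inv = 0 := biproduct.hom_ext' _ _ fun g => by rw [hcon g, comp_zero]
    exact id_nonzero X (by rw [← e.hom_inv_id, this, comp_zero])
  obtain ⟨g, hg⟩ := hne
  have : IsIso (biproduct.ι Y g ≫ e.inv) := isIso_of_mono_of_nonzero hg
  exact ⟨g, 𝒢.of_iso g _ _ (asIso (biproduct.ι Y g ≫ e.inv)) (hY g)⟩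

theorem component_iff_of_hom_ne_zero {g : G} {S X : C} [Simple S] {f : S ⟶ X} (hf : f ≠ 0) {h : G}
    (hX : 𝒢.component h X) : 𝒢.component g S ↔ g = h := by
  obtain ⟨g', hg'⟩ := 𝒢.exists_component S
  have hg'h : g' = h := by
    by_contra hne
    exact hf (𝒢.hom_eq_zero g' h hne _ _ hg' hX f)
  subst hg'h
  exact ⟨fun hg => 𝒢.component_unique (Simple.not_isZero S) hg hg', fun h => h ▸ hg'⟩

theorem component_iff_simple (k : Type u) [Field k] [Linear k C] [MonoidalPreadditive C]
    [MonoidalLinear k C] [IsFusionCategory k C] (g : G) (X : C) : 𝒢.component g X ↔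
    ∀ S : C, Simple S → (∃ f : S ⟶ X, f ≠ 0) → 𝒢.component g S := by
  refine ⟨fun hX S hS ⟨f, hf⟩ => (𝒢.component_iff_of_hom_ne_zero hf hX).2 rfl, fun H => ?_⟩
  obtain ⟨n, S, hS, ⟨e⟩⟩ := IsFusionCategory.semisimple k X
  refine 𝒢.of_iso g _ _ e.symm (𝒢.component_biproduct fun j => H _ (hS j) ?_)
  refine ⟨biproduct.ι S j ≫ e.inv, fun h => ?_⟩
  rw [Preadditive.IsIso.comp_right_eq_zero] at h
  have := hS j
  exact id_nonzero (S j) (by rw [← biproduct.ι_π_self, h, zero_comp])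

/-- The simple objects of the trivial component are `𝟙` and `δ`, where `δ` is a nontrivial object
of order two. -/
structure IsGeneratedByInvolution (δ : C) : Prop where
  mem : 𝒢.component 1 δ
  mul_self : toSkeleton δ * toSkeleton δ = 1
  ne_one : toSkeleton δ ≠ 1
  eq_or_eq : ∀ S : C, Simple S → 𝒢.component 1 S →
    toSkeleton S = 1 ∨ toSkeleton S = toSkeleton δ

/-! ### Simple objects of the components and their products. -/

namespace IsGeneratedByInvolution

variable {𝒢} {δ : C}

theorem isUnit (hδ : 𝒢.IsGeneratedByInvolution δ) : IsUnit (toSkeleton δ) :=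
  ⟨⟨_, _, hδ.mul_self, hδ.mul_self⟩, rfl⟩

theorem isUnit_of_component_one (hδ : 𝒢.IsGeneratedByInvolution δ) (S : C) [Simple S]
    (hS : 𝒢.component 1 S) : IsUnit (toSkeleton S) := by
  rcases hδ.eq_or_eq S inferInstance hS with h | h <;> rw [h]
  · exact isUnit_one
  · exact hδ.isUnit

variable [MonoidalPreadditive C]

/-- The length of an object of the trivial component. -/
theorem length_eq (hδ : 𝒢.IsGeneratedByInvolution δ) (k : Type u) [Field k] [IsAlgClosed k]
    [Linear k C] [MonoidalLinear k C] [IsFusionCategory k C] {n : ℕ} {S : Fin n → C}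
    (hS : ∀ i, Simple (S i)) (hS1 : ∀ i, 𝒢.component 1 (S i)) :
    n = Module.finrank k (𝟙_ C ⟶ ⨁ S) + Module.finrank k (δ ⟶ ⨁ S) := by
  classical
  have := finiteDimensional_hom_of_isFusionCategory k (C := C)
  have h1 : Simple (𝟙_ C) := IsFusionCategory.simple_unit k
  have h2 : Simple δ := simple_of_isUnit hδ.isUnit
  rw [finrank_hom_biproduct, finrank_hom_biproduct, ← Finset.sum_add_distrib]
  conv_lhs => rw [← Fintype.card_fin n, Fintype.card_eq_sum_ones]
  refine Finset.sum_congr rfl fun i _ => ?_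
  have := hS i
  rw [finrank_hom_simple, finrank_hom_simple, ← Skeleton.one_eq]
  rcases hδ.eq_or_eq _ (hS i) (hS1 i) with h | h <;> rw [h]
  · simp [hδ.ne_one]
  · simp [hδ.ne_one.symm]

theorem exists_decomposition (hδ : 𝒢.IsGeneratedByInvolution δ) (k : Type u) [Field k]
    [IsAlgClosed k] [Linear k C] [MonoidalLinear k C] [IsFusionCategory k C] {X : C}
    (hX : 𝒢.component 1 X) :
    ∃ (n : ℕ) (S : Fin n → C), n = Module.finrank k (𝟙_ C ⟶ X) + Module.finrank k (δ ⟶ X) ∧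
      (∀ i, Simple (S i)) ∧ (∀ i, 𝒢.component 1 (S i)) ∧ Nonempty (X ≅ ⨁ S) := by
  obtain ⟨n, S, hS, ⟨e⟩⟩ := IsFusionCategory.semisimple k X
  have hS1 : ∀ i, 𝒢.component 1 (S i) := fun i =>
    𝒢.component_of_retract ⟨biproduct.ι S i ≫ e.inv, e.hom ≫ biproduct.π S i, by simp⟩ hX
  have hn := hδ.length_eq k hS hS1
  rw [← finrank_hom_congr k (Iso.refl _) e, ← finrank_hom_congr k (Iso.refl _) e] at hn
  exact ⟨n, S, hn, hS, hS1, ⟨e⟩⟩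

theorem eq_one_of_finrank (hδ : 𝒢.IsGeneratedByInvolution δ) (k : Type u) [Field k]
    [IsAlgClosed k] [Linear k C] [MonoidalLinear k C] [IsFusionCategory k C] {X : C}
    (hX : 𝒢.component 1 X) (h1 : Module.finrank k (𝟙_ C ⟶ X) = 1)
    (h2 : Module.finrank k (δ ⟶ X) = 0) : toSkeleton X = 1 := by
  have := finiteDimensional_hom_of_isFusionCategory k (C := C)
  obtain ⟨n, S, hn, hS, hS1, ⟨e⟩⟩ := hδ.exists_decomposition k hX
  rw [h1, h2, add_zero] at hn
  subst hn
  have e' : X ≅ S 0 := e ≪≫ biproductUniqueIso S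
  have hX' : Simple X := (Simple.iff_of_iso e').2 (hS 0)
  have h3 : Simple (𝟙_ C) := IsFusionCategory.simple_unit k
  have hδ' : Simple δ := simple_of_isUnit hδ.isUnit
  refine (hδ.eq_or_eq X hX' hX).resolve_right fun h => ?_
  rw [finrank_hom_simple, if_pos h.symm] at h2
  exact one_ne_zero h2

/-- `X ⊗ Xᘁ` lies in the trivial component and contains `𝟙` once; by adjunction it contains `δ` once
or not at all, according to whether `δ ⊗ X ≅ X`. -/
theorem isInvertibleObj_iff (hδ : 𝒢.IsGeneratedByInvolution δ) (k : Type u) [Field k]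
    [IsAlgClosed k] [Linear k C] [MonoidalLinear k C] [IsFusionCategory k C] (X : C) [Simple X] :
    IsInvertibleObj X ↔ toSkeleton δ * toSkeleton X ≠ toSkeleton X := by
  classical
  have := finiteDimensional_hom_of_isFusionCategory k (C := C)
  have h1 : Simple (𝟙_ C) := IsFusionCategory.simple_unit k
  have hδ' : Simple δ := simple_of_isUnit hδ.isUnit
  have hδX : Simple (δ ⊗ X) := simple_tensor_of_isUnit_left hδ.isUnit X
  have h1X : Simple (𝟙_ C ⊗ X) := Simple.of_iso (λ_ X)
  have key : Module.finrank k (δ ⟶ X ⊗ Xᘁ) = if toSkeleton δ * toSkeleton X = toSkeleton X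
      then 1 else 0 := by
    rw [← finrank_tensorRight_hom k δ X (Xᘁ) X, finrank_hom_simple, Skeleton.toSkeleton_tensorObj]
  constructor
  · rintro ⟨e⟩ h
    rw [if_pos h, finrank_hom_congr k (Iso.refl δ) e, finrank_hom_simple,
      ← Skeleton.one_eq, if_neg hδ.ne_one] at key
    exact zero_ne_one key
  · intro h
    rw [if_neg h] at key
    rw [IsInvertibleObj, ← toSkeleton_eq_toSkeleton_iff]
    obtain ⟨g, hg⟩ := 𝒢.exists_component X
    refine hδ.eq_one_of_finrank k ?_ ?_ key
    · simpa using 𝒢.tensor _ _ _ _ hg ((𝒢.dual _ _).1 hg)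
    · rw [← finrank_tensorRight_hom k (𝟙_ C) X (Xᘁ) X, finrank_hom_simple,
        if_pos (congr_toSkeleton_of_iso (λ_ X))]

/-- Mirror image of the previous argument, used to make `Xᘁ` a two-sided inverse. -/
theorem dual_mul_eq_one (hδ : 𝒢.IsGeneratedByInvolution δ) (k : Type u) [Field k]
    [IsAlgClosed k] [Linear k C] [MonoidalLinear k C] [IsFusionCategory k C] (X : C) [Simple X]
    (h : toSkeleton X * toSkeleton δ ≠ toSkeleton X) : toSkeleton (Xᘁ ⊗ X) = 1 := by
  classical
  have := finiteDimensional_hom_of_isFusionCategory k (C := C)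
  have h1 : Simple (𝟙_ C) := IsFusionCategory.simple_unit k
  have hδ' : Simple δ := simple_of_isUnit hδ.isUnit
  have hδX : Simple (X ⊗ δ) := simple_tensor_of_isUnit_right hδ.isUnit X
  have h1X : Simple (X ⊗ 𝟙_ C) := Simple.of_iso (ρ_ X)
  obtain ⟨g, hg⟩ := 𝒢.exists_component X
  refine hδ.eq_one_of_finrank k ?_ ?_ ?_
  · simpa using 𝒢.tensor _ _ _ _ ((𝒢.dual _ _).1 hg) hg
  · rw [finrank_hom_simple_comm, finrank_tensorLeft_hom k X X (Xᘁ) _, finrank_hom_simple,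
      if_pos (congr_toSkeleton_of_iso (ρ_ X)).symm]
  · rw [finrank_hom_simple_comm, finrank_tensorLeft_hom k X X (Xᘁ) _, finrank_hom_simple,
      Skeleton.toSkeleton_tensorObj, if_neg h.symm]

/-- A component contains at most two simple objects. -/
theorem eq_or_eq_mul_right (hδ : 𝒢.IsGeneratedByInvolution δ) (k : Type u) [Field k]
    [IsAlgClosed k] [Linear k C] [MonoidalLinear k C] [IsFusionCategory k C] {g : G} {X Y : C}
    [Simple X] [Simple Y] (hX : 𝒢.component g X) (hY : 𝒢.component g Y) :
    toSkeleton Y = toSkeleton X ∨ toSkeleton Y = toSkeleton X * toSkeleton δ := by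
  classical
  have := finiteDimensional_hom_of_isFusionCategory k (C := C)
  have h1 : Simple (𝟙_ C) := IsFusionCategory.simple_unit k
  have hXd : ¬ IsZero (Xᘁ) := fun h =>
    coevaluation_ne_zero (X := X) (Y := Xᘁ) (Simple.not_isZero X)
      (((tensorLeft X).map_isZero h).eq_of_tgt _ _)
  -- A constituent `S` of `Xᘁ ⊗ Y` has degree 1, hence is `𝟙` or `δ`; by adjunction there is a
  -- nonzero map between the simple objects `Y` and `X ⊗ S`.
  obtain ⟨S, hS, f, hf⟩ := exists_simple_hom_ne_zero k
    (not_isZero_tensor hXd (Simple.not_isZero Y))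
  have hS1 : 𝒢.component 1 S := (𝒢.component_iff_of_hom_ne_zero hf
    (𝒢.tensor _ _ _ _ ((𝒢.dual _ _).1 hX) hY)).2 (by simp)
  have hXS : Simple (X ⊗ S) := simple_tensor_of_isUnit_right (hδ.isUnit_of_component_one S hS1) X
  have hpos := (finrank_hom_pos_iff k).2 ⟨f, hf⟩
  rw [finrank_hom_simple_comm, finrank_tensorLeft_hom k Y X (Xᘁ) _, finrank_hom_simple,
    Skeleton.toSkeleton_tensorObj] at hpos
  have heq : toSkeleton Y = toSkeleton X * toSkeleton S := by
    by_contra hne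
    simp [hne] at hpos
  rcases hδ.eq_or_eq S hS hS1 with h | h <;> rw [h] at heq
  · exact Or.inl (by rw [heq, mul_one])
  · exact Or.inr heq

theorem eq_or_eq_mul_left (hδ : 𝒢.IsGeneratedByInvolution δ) (k : Type u) [Field k]
    [IsAlgClosed k] [Linear k C] [MonoidalLinear k C] [IsFusionCategory k C] {g : G} {X Y : C}
    [Simple X] [Simple Y] (hX : 𝒢.component g X) (hY : 𝒢.component g Y) :
    toSkeleton Y = toSkeleton X ∨ toSkeleton Y = toSkeleton δ * toSkeleton X := by
  classical
  have := finiteDimensional_hom_of_isFusionCategory k (C := C)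
  have h1 : Simple (𝟙_ C) := IsFusionCategory.simple_unit k
  have hXd : ¬ IsZero (ᘁX : C) := not_isZero_of_exactPairing (Y := X) (Simple.not_isZero X)
  obtain ⟨S, hS, f, hf⟩ := exists_simple_hom_ne_zero k
    (not_isZero_tensor (Simple.not_isZero Y) hXd)
  have hS1 : 𝒢.component 1 S := (𝒢.component_iff_of_hom_ne_zero hf
    (𝒢.tensor _ _ _ _ hY (𝒢.component_leftDual hX))).2 (by simp)
  have hXS : Simple (S ⊗ X) := simple_tensor_of_isUnit_left (hδ.isUnit_of_component_one S hS1) X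
  have hpos := (finrank_hom_pos_iff k).2 ⟨f, hf⟩
  rw [finrank_hom_simple_comm, finrank_tensorRight_hom k Y (ᘁX : C) X _, finrank_hom_simple,
    Skeleton.toSkeleton_tensorObj] at hpos
  have heq : toSkeleton Y = toSkeleton S * toSkeleton X := by
    by_contra hne
    simp [hne] at hpos
  rcases hδ.eq_or_eq S hS hS1 with h | h <;> rw [h] at heq
  · exact Or.inl (by rw [heq, one_mul])
  · exact Or.inr heq

/-- If `δ` fixes `X` on one side, the component of `X` has a single simple object; the product with
`δ` on the other side is simple of the same degree, so it is `X` too. -/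
theorem mul_right_eq_iff (hδ : 𝒢.IsGeneratedByInvolution δ) (k : Type u) [Field k]
    [IsAlgClosed k] [Linear k C] [MonoidalLinear k C] [IsFusionCategory k C] (X : C) [Simple X] :
    toSkeleton X * toSkeleton δ = toSkeleton X ↔ toSkeleton δ * toSkeleton X = toSkeleton X := by
  obtain ⟨g, hg⟩ := 𝒢.exists_component X
  have hl : Simple (δ ⊗ X) := simple_tensor_of_isUnit_left hδ.isUnit X
  have hr : Simple (X ⊗ δ) := simple_tensor_of_isUnit_right hδ.isUnit X
  have hlg : 𝒢.component g (δ ⊗ X) := by simpa using 𝒢.tensor _ _ _ _ hδ.mem hg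
  have hrg : 𝒢.component g (X ⊗ δ) := by simpa using 𝒢.tensor _ _ _ _ hg hδ.mem
  constructor
  · intro h
    have := hδ.eq_or_eq_mul_right k hg hlg
    rwa [h, or_self, Skeleton.toSkeleton_tensorObj] at this
  · intro h
    have := hδ.eq_or_eq_mul_left k hg hrg
    rwa [h, or_self, Skeleton.toSkeleton_tensorObj] at this

theorem isUnit_iff (hδ : 𝒢.IsGeneratedByInvolution δ) (k : Type u) [Field k]
    [IsAlgClosed k] [Linear k C] [MonoidalLinear k C] [IsFusionCategory k C] (X : C) [Simple X] :
    IsUnit (toSkeleton X) ↔ toSkeleton δ * toSkeleton X ≠ toSkeleton X := by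
  constructor
  · intro h h'
    exact hδ.ne_one (h.mul_right_cancel (h'.trans (one_mul _).symm))
  · intro h
    refine (isUnit_toSkeleton_iff X).2 ⟨Xᘁ, (hδ.isInvertibleObj_iff k X).2 h, ?_⟩
    rw [← toSkeleton_eq_toSkeleton_iff]
    exact hδ.dual_mul_eq_one k X fun h' => h ((hδ.mul_right_eq_iff k X).1 h')

theorem isInvertibleObj_iff_isUnit (hδ : 𝒢.IsGeneratedByInvolution δ) (k : Type u) [Field k]
    [IsAlgClosed k] [Linear k C] [MonoidalLinear k C] [IsFusionCategory k C] (X : C) [Simple X] :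
    IsInvertibleObj X ↔ IsUnit (toSkeleton X) := by
  rw [hδ.isInvertibleObj_iff k, hδ.isUnit_iff k]

/-- A component with a non-invertible simple object has only one simple object. -/
theorem eq_of_not_isUnit (hδ : 𝒢.IsGeneratedByInvolution δ) (k : Type u) [Field k]
    [IsAlgClosed k] [Linear k C] [MonoidalLinear k C] [IsFusionCategory k C] {g : G} {X Y : C}
    [Simple X] [Simple Y] (hX : 𝒢.component g X) (hY : 𝒢.component g Y)
    (h : ¬ IsUnit (toSkeleton X)) : toSkeleton Y = toSkeleton X := by
  rw [hδ.isUnit_iff k, not_not] at h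
  have := hδ.eq_or_eq_mul_left k hX hY
  rwa [h, or_self] at this

/-- By adjunction this is `dim Hom(X, X ⊗ (Y ⊗ Yᘁ))`. The object `Y ⊗ Yᘁ` has two simple summands,
each `𝟙` or `δ`, and both kinds fix `X` from the right. -/
theorem finrank_end_tensor (hδ : 𝒢.IsGeneratedByInvolution δ) (k : Type u) [Field k]
    [IsAlgClosed k] [Linear k C] [MonoidalLinear k C] [IsFusionCategory k C] {X Y : C}
    [Simple X] [Simple Y] (hX : ¬ IsUnit (toSkeleton X)) (hY : ¬ IsUnit (toSkeleton Y)) :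
    Module.finrank k (X ⊗ Y ⟶ X ⊗ Y) = 2 := by
  classical
  have := finiteDimensional_hom_of_isFusionCategory k (C := C)
  have h1 : Simple (𝟙_ C) := IsFusionCategory.simple_unit k
  have hδ' : Simple δ := simple_of_isUnit hδ.isUnit
  have hδY : Simple (δ ⊗ Y) := simple_tensor_of_isUnit_left hδ.isUnit Y
  have h1Y : Simple (𝟙_ C ⊗ Y) := Simple.of_iso (λ_ Y)
  rw [hδ.isUnit_iff k, not_not] at hX hY
  rw [← hδ.mul_right_eq_iff k] at hX
  obtain ⟨g, hg⟩ := 𝒢.exists_component Y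
  have hYY : 𝒢.component 1 (Y ⊗ Yᘁ) := by
    simpa using 𝒢.tensor _ _ _ _ hg ((𝒢.dual _ _).1 hg)
  obtain ⟨n, S, hn, hS, hS1, ⟨e⟩⟩ := hδ.exists_decomposition k hYY
  rw [← finrank_tensorRight_hom k (𝟙_ C) Y (Yᘁ) Y, ← finrank_tensorRight_hom k δ Y (Yᘁ) Y,
    finrank_hom_simple,
    finrank_hom_simple, Skeleton.toSkeleton_tensorObj, Skeleton.toSkeleton_tensorObj, hY,
    ← Skeleton.one_eq, one_mul, if_pos rfl] at hn
  rw [finrank_tensorRight_hom k X Y (Yᘁ) _, finrank_hom_congr k (Iso.refl X)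
    (α_ _ _ _ ≪≫ whiskerLeftIso X e ≪≫ leftDistributor X S), finrank_hom_biproduct]
  have : ∀ i, Module.finrank k (X ⟶ X ⊗ S i) = 1 := by
    intro i
    have := hS i
    have := simple_tensor_of_isUnit_right (hδ.isUnit_of_component_one (S i) (hS1 i)) X
    rw [finrank_hom_simple, Skeleton.toSkeleton_tensorObj, if_pos]
    rcases hδ.eq_or_eq _ (hS i) (hS1 i) with h | h <;> rw [h]
    · rw [mul_one]
    · exact hX.symm
  simp [this, hn]

/-- The product of two non-invertible simple objects is the sum of two invertible objects. -/
theorem tensor_of_not_isUnit (hδ : 𝒢.IsGeneratedByInvolution δ) (k : Type u) [Field k]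
    [IsAlgClosed k] [Linear k C] [MonoidalLinear k C] [IsFusionCategory k C] {X Y : C}
    [Simple X] [Simple Y] (hX : ¬ IsUnit (toSkeleton X)) (hY : ¬ IsUnit (toSkeleton Y)) :
    ∃ S : Fin 2 → C, (∀ i, IsUnit (toSkeleton (S i))) ∧ Nonempty (X ⊗ Y ≅ ⨁ S) := by
  classical
  have := finiteDimensional_hom_of_isFusionCategory k (C := C)
  obtain ⟨g, hg⟩ := 𝒢.exists_component X
  obtain ⟨h, hh⟩ := 𝒢.exists_component Y
  have hXY := 𝒢.tensor _ _ _ _ hg hh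
  obtain ⟨n, S, hS, ⟨e⟩⟩ := IsFusionCategory.semisimple k (X ⊗ Y)
  have hSg : ∀ i, 𝒢.component (g * h) (S i) := fun i =>
    𝒢.component_of_retract ⟨biproduct.ι S i ≫ e.inv, e.hom ≫ biproduct.π S i, by simp⟩ hXY
  have hend := hδ.finrank_end_tensor k hX hY
  rw [finrank_hom_congr k e e, finrank_biproduct_hom] at hend
  simp only [finrank_hom_biproduct, finrank_hom_simple] at hend
  -- All summands share the degree `g * h`. If one were non-invertible, it would be the only simple
  -- object there and `End(X ⊗ Y)` would have dimension `n * n`, which is never 2.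
  have hunit : ∀ i, IsUnit (toSkeleton (S i)) := by
    by_contra! hcon
    obtain ⟨i, hi⟩ := hcon
    have hall : ∀ j, toSkeleton (S j) = toSkeleton (S i) := fun j =>
      hδ.eq_of_not_isUnit k (hSg i) (hSg j) hi
    simp only [hall, if_true, Finset.sum_const, Finset.card_univ, Fintype.card_fin,
      smul_eq_mul, mul_one] at hend
    have : n < 2 := by nlinarith
    interval_cases n <;> omega
  -- The diagonal terms alone contribute `n` to the dimension of the endomorphism space.
  have hn : n ≤ 2 := by
    rw [← hend]
    calc n = ∑ i : Fin n, 1 := by simp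
      _ ≤ _ := Finset.sum_le_sum fun i _ =>
        le_trans (by simp) (Finset.single_le_sum (fun _ _ => Nat.zero_le _) (Finset.mem_univ i))
  have hn2 : n = 2 := by
    interval_cases n
    · simp at hend
    · rw [Fin.sum_univ_one, Fin.sum_univ_one, if_pos rfl] at hend
      omega
    · rfl
  subst hn2
  exact ⟨S, hunit, ⟨e⟩⟩

end IsGeneratedByInvolution

end FusionGrading

/-! ### The involution coming from `Vec^ω`. -/

namespace FusionGrading

variable {G : Type t} [Group G] [Finite G] {C : Type v} [Category.{w} C] [Abelian C]
  [MonoidalCategory C] [RigidCategory C] {𝒢 : FusionGrading G C}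

/-- `δ` is the image of the line of nontrivial degree. The triviality clause is kept together with
it because it needs the functor from `Vec^ω`, not just the class of `δ`. -/
theorem IsExtensionOf.exists_isGeneratedByInvolution {k : Type u} [Field k] [IsAlgClosed k]
    [Linear k C] [MonoidalPreadditive C] [MonoidalLinear k C] [IsFusionCategory k C]
    {ω : ThreeCocycle (Multiplicative (ZMod 2)) k} (h𝒢 : 𝒢.IsExtensionOf k (TwistedVect ω)) :
    ∃ δ : C, 𝒢.IsGeneratedByInvolution δ ∧
      ∀ X : C, Simple X → toSkeleton δ * toSkeleton X = toSkeleton X → ω.IsTrivial := by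
  have := finiteDimensional_hom_of_isFusionCategory k (C := C)
  have h1 : Simple (𝟙_ C) := IsFusionCategory.simple_unit k
  have := 𝒢.isMonoidal h1
  obtain ⟨-, F₀, hF, hadd, hlin, ⟨hmon⟩⟩ := h𝒢
  let F : TwistedVect ω ⥤ C := F₀ ⋙ (𝒢.component 1).ι
  have hFadd : F.Additive := inferInstanceAs (F₀ ⋙ (𝒢.component 1).ι).Additive
  have hFlin : F.Linear k := inferInstanceAs ((F₀ ⋙ (𝒢.component 1).ι).Linear k)
  have hFfull : F.Full := inferInstanceAs (F₀ ⋙ (𝒢.component 1).ι).Full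
  have hFfaith : F.Faithful := inferInstanceAs (F₀ ⋙ (𝒢.component 1).ι).Faithful
  let hFmon : F.Monoidal := inferInstanceAs (F₀ ⋙ (𝒢.component 1).ι).Monoidal
  obtain ⟨m, hm⟩ := TwistedVect.exists_lineMul_map F
  let A : Multiplicative (ZMod 2) → C := fun a => F.obj (TwistedVect.line ω a)
  let σ : Multiplicative (ZMod 2) := Multiplicative.ofAdd 1
  have hσ : ∀ a : Multiplicative (ZMod 2), a = 1 ∨ a = σ := by decide
  have hA1 : toSkeleton (A 1) = 1 :=
    congr_toSkeleton_of_iso (F.mapIso (TwistedVect.lineOneIso ω).symm ≪≫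
      (Functor.Monoidal.εIso F).symm)
  have hAmul : ∀ {a b c : Multiplicative (ZMod 2)}, a * b = c →
      toSkeleton (A a) * toSkeleton (A b) = toSkeleton (A c) := fun h => by
    rw [← Skeleton.toSkeleton_tensorObj]
    exact congr_toSkeleton_of_iso (m h)
  have hsq : toSkeleton (A σ) * toSkeleton (A σ) = 1 := (hAmul (by decide)).trans hA1
  have hsimple : ∀ a, Simple (A a) := fun a => simple_of_isUnit (by
    rcases hσ a with rfl | rfl
    · rw [hA1]; exact isUnit_one
    · exact ⟨⟨_, _, hsq, hsq⟩, rfl⟩)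
  refine ⟨A σ, ⟨(F₀.obj _).property, hsq, ?_, ?_⟩, ?_⟩
  · rw [← hA1]
    intro h
    obtain ⟨e⟩ := toSkeleton_eq_toSkeleton_iff.1 h
    -- Since `F` is full, an isomorphism `A σ ≅ A 1` would come from a map between lines of
    -- different degrees, which is zero.
    have h0 : F.preimage e.hom = 0 := TwistedVect.line_hom_eq_zero (by decide) _
    have h2 : e.hom = 0 := by rw [← F.map_preimage e.hom, h0, F.map_zero]
    have := hsimple σ
    exact id_nonzero (A σ) (by rw [← e.hom_inv_id, h2, zero_comp])
  · intro S hS hS1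
    obtain ⟨V, ⟨e⟩⟩ : ∃ V, Nonempty (F.obj V ≅ S) :=
      ⟨F₀.objPreimage ⟨S, hS1⟩, ⟨(𝒢.component 1).ι.mapIso (F₀.objObjPreimageIso ⟨S, hS1⟩)⟩⟩
    have hV : 𝟙 V ≠ 0 := fun h => by
      have : 𝟙 (F.obj V) = 0 := by rw [← F.map_id, h, F.map_zero]
      exact id_nonzero S (by rw [← e.inv_hom_id, ← Category.id_comp e.hom, this]; simp)
    obtain ⟨a, f, hf⟩ := TwistedVect.exists_line_hom_ne_zero V hV
    have := hsimple a
    have hg : F.map f ≫ e.hom ≠ 0 := fun h => hf (F.map_injective (by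
      rw [Preadditive.IsIso.comp_right_eq_zero] at h
      rw [h, F.map_zero]))
    have hiso : IsIso (F.map f ≫ e.hom) := isIso_of_hom_simple hg
    have hSa : toSkeleton S = toSkeleton (A a) :=
      congr_toSkeleton_of_iso (asIso (F.map f ≫ e.hom)).symm
    rcases hσ a with rfl | rfl
    · exact Or.inl (hSa.trans hA1)
    · exact Or.inr hSa
  · intro X hX h
    -- The group has only the elements `1` and `σ`, so being fixed by `δ` means being fixed by every
    -- `A a`.
    have hfix : ∀ a, Nonempty (A a ⊗ X ≅ X) := fun a => by
      rw [← toSkeleton_eq_toSkeleton_iff, Skeleton.toSkeleton_tensorObj]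
      rcases hσ a with rfl | rfl
      · rw [hA1, one_mul]
      · exact h
    refine ω.isTrivial_of_fixed A m hm X (fun f => ?_) (id_nonzero X) fun a => (hfix a).some
    obtain ⟨c, hc⟩ := endomorphism_simple_eq_smul_id k f
    exact ⟨c, hc.symm⟩

end FusionGrading

/-! ### Perron–Frobenius bound and dimensions of simple objects. -/

section PerronFrobenius

/-- A nonnegative matrix with a positive left eigenvector has the corresponding eigenvalue as its
largest eigenvalue. -/
theorem Matrix.isGreatest_of_left_eigenvector {ι : Type*} [Fintype ι] [Nonempty ι]
    (M : Matrix ι ι ℝ) (hM : ∀ i j, 0 ≤ M i j) (d : ι → ℝ) (hd : ∀ i, 0 < d i) (r : ℝ)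
    (h : ∀ j, ∑ i, d i * M i j = r * d j) :
    IsGreatest {s : ℝ | ∃ v : ι → ℝ, v ≠ 0 ∧ ∀ i, ∑ j, M i j * v j = s * v i} r := by
  classical
  constructor
  · have hleft : ∃ v, v ≠ 0 ∧ Matrix.vecMul v (M - Matrix.scalar ι r) = 0 := by
      refine ⟨d, fun h0 => ?_, ?_⟩
      · obtain ⟨i⟩ := ‹Nonempty ι›
        exact (hd i).ne' (congrFun h0 i)
      · ext j
        have := h j
        simp only [Matrix.vecMul_sub, Pi.sub_apply, Pi.zero_apply]
        rw [Matrix.scalar_apply, Matrix.vecMul_diagonal, Matrix.vecMul, dotProduct, this]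
        ring
    rw [Matrix.exists_vecMul_eq_zero_iff, ← Matrix.exists_mulVec_eq_zero_iff] at hleft
    obtain ⟨v, hv, hv'⟩ := hleft
    refine ⟨v, hv, fun i => ?_⟩
    have := congrFun hv' i
    simp only [Matrix.sub_mulVec, Pi.sub_apply, Pi.zero_apply] at this
    rw [Matrix.scalar_apply, Matrix.mulVec_diagonal, Matrix.mulVec, dotProduct] at this
    linarith
  · rintro s ⟨v, hv, hs⟩
    -- Pairing `s * |v i| ≤ ∑ j, M i j * |v j|` with the positive vector `d` gives `s ≤ r` after
    -- division by this sum.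
    have hpos : 0 < ∑ i, d i * |v i| := by
      obtain ⟨i, hi⟩ := Function.ne_iff.1 hv
      exact Finset.sum_pos' (fun j _ => mul_nonneg (hd j).le (abs_nonneg _))
        ⟨i, Finset.mem_univ i, mul_pos (hd i) (abs_pos.2 hi)⟩
    refine le_of_mul_le_mul_right ?_ hpos
    calc s * ∑ i, d i * |v i| = ∑ i, d i * (s * |v i|) := by
          rw [Finset.mul_sum]
          exact Finset.sum_congr rfl fun i _ => by ring
      _ ≤ ∑ i, d i * ∑ j, M i j * |v j| := by
          refine Finset.sum_le_sum fun i _ => mul_le_mul_of_nonneg_left ?_ (hd i).le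
          calc s * |v i| ≤ |s| * |v i| := mul_le_mul_of_nonneg_right (le_abs_self s) (abs_nonneg _)
            _ = |∑ j, M i j * v j| := by rw [hs, abs_mul]
            _ ≤ ∑ j, |M i j * v j| := Finset.abs_sum_le_sum_abs _ _
            _ = ∑ j, M i j * |v j| :=
              Finset.sum_congr rfl fun j _ => by rw [abs_mul, abs_of_nonneg (hM i j)]
      _ = ∑ j, (∑ i, d i * M i j) * |v j| := by
          simp only [Finset.mul_sum, Finset.sum_mul]
          rw [Finset.sum_comm]
          exact Finset.sum_congr rfl fun i _ => Finset.sum_congr rfl fun j _ => by ring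
      _ = r * ∑ i, d i * |v i| := by
          rw [Finset.mul_sum]
          exact Finset.sum_congr rfl fun i _ => by rw [h]; ring

end PerronFrobenius

section SimpleDimension

variable {C : Type v} [Category.{w} C] [MonoidalCategory C]

open Classical in
/-- The dimension of a simple object: `1` if it is invertible and `√2` if not. -/
noncomputable def simpleDim (X : C) : ℝ := if IsUnit (toSkeleton X) then 1 else √2

theorem simpleDim_pos (X : C) : 0 < simpleDim X := by
  unfold simpleDim
  split_ifs <;> positivity

end SimpleDimension

namespace FusionGrading.IsGeneratedByInvolution

variable {G : Type t} [Group G] [Finite G] {C : Type v} [Category.{w} C] [Abelian C]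
  [MonoidalCategory C] [RigidCategory C] {𝒢 : FusionGrading G C} {δ : C} [MonoidalPreadditive C]

section Dimension

/-- The sum is the additive extension of `simpleDim` to arbitrary objects; on a simple object only
its own class contributes. -/
theorem sum_simpleDim (k : Type u) [Field k] [IsAlgClosed k] [Linear k C] [MonoidalLinear k C]
    [IsFusionCategory k C] [Fintype (Irr C)] (S : C) [Simple S] :
    ∑ z : Irr C, simpleDim z.rep * (Module.finrank k (z.rep ⟶ S) : ℝ) = simpleDim S := by
  classical
  have := finiteDimensional_hom_of_isFusionCategory k (C := C)
  obtain ⟨x, ⟨e⟩⟩ := Irr.exists_rep_iso S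
  have hx := congr_toSkeleton_of_iso e
  rw [Finset.sum_eq_single x]
  · rw [finrank_hom_simple, if_pos hx, simpleDim, simpleDim, hx]
    simp
  · intro z _ hz
    rw [finrank_hom_simple, if_neg, Nat.cast_zero, mul_zero]
    rwa [← hx, ← Irr.eq_iff]
  · simp

/-- Tensoring with an invertible object preserves simplicity and invertibility, and for two
non-invertible factors `√2 * √2 = 1 + 1`. This makes `simpleDim` a positive left eigenvector of
`fusionMatrix k X` with eigenvalue `simpleDim X`. -/
theorem simpleDim_tensor (hδ : 𝒢.IsGeneratedByInvolution δ) (k : Type u) [Field k]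
    [IsAlgClosed k] [Linear k C] [MonoidalLinear k C] [IsFusionCategory k C] [Fintype (Irr C)]
    (X Y : C) [Simple X] [Simple Y] :
    ∑ z : Irr C, simpleDim z.rep * (Module.finrank k (z.rep ⟶ X ⊗ Y) : ℝ) =
      simpleDim X * simpleDim Y := by
  have := finiteDimensional_hom_of_isFusionCategory k (C := C)
  have h1 : Simple (𝟙_ C) := IsFusionCategory.simple_unit k
  by_cases hX : IsUnit (toSkeleton X)
  · have := simple_tensor_of_isUnit_left hX Y
    rw [sum_simpleDim, simpleDim, simpleDim, simpleDim, if_pos hX, one_mul,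
      Skeleton.toSkeleton_tensorObj]
    congr 1
    obtain ⟨u, hu⟩ := hX
    rw [← hu, Units.isUnit_units_mul]
  · by_cases hY : IsUnit (toSkeleton Y)
    · have := simple_tensor_of_isUnit_right hY X
      rw [sum_simpleDim, simpleDim, simpleDim, simpleDim, if_pos hY, mul_one,
        Skeleton.toSkeleton_tensorObj]
      congr 1
      obtain ⟨u, hu⟩ := hY
      rw [← hu, Units.isUnit_mul_units]
    · obtain ⟨S, hS, ⟨e⟩⟩ := hδ.tensor_of_not_isUnit k hX hY
      have hS' : ∀ i, Simple (S i) := fun i => simple_of_isUnit (hS i)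
      have hz : ∀ z : Irr C, (Module.finrank k (z.rep ⟶ X ⊗ Y) : ℝ) =
          Module.finrank k (z.rep ⟶ S 0) + Module.finrank k (z.rep ⟶ S 1) := fun z => by
        rw [finrank_hom_congr k (Iso.refl _) e, finrank_hom_biproduct, Fin.sum_univ_two,
          Nat.cast_add]
      simp only [hz, mul_add, Finset.sum_add_distrib]
      rw [sum_simpleDim, sum_simpleDim, simpleDim, simpleDim, simpleDim, simpleDim,
        if_pos (hS 0), if_pos (hS 1), if_neg hX, if_neg hY, Real.mul_self_sqrt (by norm_num)]
      norm_num

theorem FPdim_eq (hδ : 𝒢.IsGeneratedByInvolution δ) (k : Type u) [Field k]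
    [IsAlgClosed k] [Linear k C] [MonoidalLinear k C] [IsFusionCategory k C]
    (X : C) [Simple X] : FPdim k X = simpleDim X := by
  have : Finite (Irr C) := IsFusionCategory.finite_irr k
  have := Fintype.ofFinite (Irr C)
  have : Nonempty (Irr C) := ⟨(Irr.exists_rep_iso X).choose⟩
  have := Matrix.isGreatest_of_left_eigenvector (fusionMatrix k X) (fun _ _ => Nat.cast_nonneg _)
    (fun z => simpleDim z.rep) (fun z => simpleDim_pos z.rep) (simpleDim X)
    (fun y => hδ.simpleDim_tensor k X y.rep)
  rw [FPdim, ← this.csSup_eq]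
  simp only [finsum_eq_sum_of_fintype]

end Dimension

end FusionGrading.IsGeneratedByInvolution

/-! ### Universal grading and adjoint subcategory. -/

theorem IsFusionSubcategory.biproduct {C : Type v} [Category.{w} C] [Abelian C]
    [MonoidalCategory C] [RigidCategory C] {P : ObjectProperty C} (hP : IsFusionSubcategory P) :
    ∀ {n : ℕ} (S : Fin n → C), (∀ i, P (S i)) → P (⨁ S)
  | 0, S, _ => by
    -- The empty biproduct is zero, hence a retract of the unit.
    refine hP.summand _ _ hP.unit ⟨⟨0, 0, ?_⟩⟩
    exact biproduct.hom_ext _ _ fun i => i.elim0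
  | n + 1, S, hS => by
    refine hP.summand _ _ (hP.biprod _ _ (hS 0)
      (hP.biproduct (fun i : Fin n => S i.succ) fun i => hS _)) ⟨⟨?_, ?_, ?_⟩⟩
    · exact biprod.lift (biproduct.π S 0) (biproduct.lift fun i => biproduct.π S i.succ)
    · exact biprod.desc (biproduct.ι S 0) (biproduct.desc fun i => biproduct.ι S i.succ)
    · rw [biprod.lift_desc, biproduct.lift_desc, ← biproduct.total, Fin.sum_univ_succ]

namespace FusionGrading

section Degree

variable {G : Type t} [Group G] [Finite G] {C : Type v} [Category.{w} C] [Abelian C]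
  [MonoidalCategory C] [RigidCategory C] (𝒢 : FusionGrading G C)

/-- The degree of a simple object. -/
noncomputable def degree (x : Irr C) : G := (𝒢.exists_component x.rep).choose

theorem component_degree (x : Irr C) : 𝒢.component (𝒢.degree x) x.rep :=
  (𝒢.exists_component x.rep).choose_spec

theorem degree_eq_iff {x : Irr C} {g : G} : 𝒢.degree x = g ↔ 𝒢.component g x.rep :=
  ⟨fun h => h ▸ 𝒢.component_degree x, fun h =>
    𝒢.component_unique (Simple.not_isZero x.rep) (𝒢.component_degree x) h⟩

theorem lift_degree_eq_one : ∀ r ∈ gradingRelations C, FreeGroup.lift 𝒢.degree r = 1 := by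
  rintro _ ⟨x, y, z, ⟨f, hf⟩, rfl⟩
  have : 𝒢.degree z = 𝒢.degree x * 𝒢.degree y :=
    (𝒢.component_iff_of_hom_ne_zero hf (𝒢.tensor _ _ _ _ (𝒢.component_degree x)
      (𝒢.component_degree y))).1 (𝒢.component_degree z)
  simp [this]

/-- The homomorphism from the universal grading group which induces the given grading. -/
noncomputable def universalHom : UniversalGradingGroup C →* G :=
  PresentedGroup.toGroup 𝒢.lift_degree_eq_one

theorem universalHom_of (x : Irr C) :
    𝒢.universalHom (PresentedGroup.of x) = 𝒢.degree x :=
  PresentedGroup.toGroup.of _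

theorem IsFaithful.exists_degree_eq {𝒢 : FusionGrading G C} (h𝒢 : 𝒢.IsFaithful)
    (k : Type u) [Field k] [Linear k C] [MonoidalPreadditive C] [MonoidalLinear k C]
    [IsFusionCategory k C] (g : G) : ∃ x : Irr C, 𝒢.degree x = g := by
  obtain ⟨X, hX, hX0⟩ := h𝒢 g
  obtain ⟨S, hS, f, hf⟩ := exists_simple_hom_ne_zero k hX0
  obtain ⟨x, ⟨e⟩⟩ := Irr.exists_rep_iso S
  exact ⟨x, 𝒢.degree_eq_iff.2 (𝒢.of_iso _ _ _ e.symm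
    ((𝒢.component_iff_of_hom_ne_zero hf hX).2 rfl))⟩

theorem isFusionSubcategory_component_one (h1 : Simple (𝟙_ C)) :
    IsFusionSubcategory (𝒢.component 1) where
  unit := 𝒢.unit_mem h1
  tensor X Y hX hY := by simpa using 𝒢.tensor 1 1 X Y hX hY
  rightDual X hX := by simpa using (𝒢.dual 1 X).1 hX
  leftDual X hX := by simpa using 𝒢.component_leftDual hX
  biprod X Y hX hY := 𝒢.component_biprod hX hY
  summand X Y hX h := 𝒢.component_of_retract h.some hX

end Degree

theorem _root_.universalGradingGroup_of_mul {C : Type v} [Category.{w} C] [Abelian C]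
    [MonoidalCategory C] {x y z : Irr C} {f : z.rep ⟶ x.rep ⊗ y.rep} (hf : f ≠ 0) :
    (PresentedGroup.of x * PresentedGroup.of y : UniversalGradingGroup C) =
      PresentedGroup.of z :=
  PresentedGroup.mk_eq_mk_of_mul_inv_mem ⟨x, y, z, ⟨f, hf⟩, rfl⟩

theorem _root_.universalGradingGroup_of_mul_of_eq {C : Type v} [Category.{w} C] [Abelian C]
    [MonoidalCategory C] {x y z : Irr C}
    (h : toSkeleton x.rep * toSkeleton y.rep = toSkeleton z.rep) :
    (PresentedGroup.of x * PresentedGroup.of y : UniversalGradingGroup C) =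
      PresentedGroup.of z := by
  rw [← Skeleton.toSkeleton_tensorObj, toSkeleton_eq_toSkeleton_iff] at h
  obtain ⟨e⟩ := h
  refine universalGradingGroup_of_mul (f := e.inv) fun h0 => ?_
  exact id_nonzero z.rep (by rw [← e.inv_hom_id, h0, zero_comp])

namespace IsGeneratedByInvolution

variable {G : Type t} [Group G] [Finite G] {C : Type v} [Category.{w} C] [Abelian C]
  [MonoidalCategory C] [RigidCategory C] {𝒢 : FusionGrading G C} {δ : C} [MonoidalPreadditive C]

/-- If `C` has a non-invertible simple object, then the simple objects of the trivial component
have trivial universal degree. -/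
theorem of_eq_one (hδ : 𝒢.IsGeneratedByInvolution δ) (k : Type u) [Field k]
    [IsAlgClosed k] [Linear k C] [MonoidalLinear k C] [IsFusionCategory k C] {X : C} [Simple X]
    (hX : ¬ IsUnit (toSkeleton X)) {z : Irr C} (hz : 𝒢.component 1 z.rep) :
    (PresentedGroup.of z : UniversalGradingGroup C) = 1 := by
  obtain ⟨x, ⟨e⟩⟩ := Irr.exists_rep_iso X
  rw [← congr_toSkeleton_of_iso e, hδ.isUnit_iff k, not_not] at hX
  -- Both `𝟙` and `δ` fix the non-invertible object, so this relation cancels to `of z = 1`.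
  have : (PresentedGroup.of z * PresentedGroup.of x : UniversalGradingGroup C) =
      PresentedGroup.of x := by
    refine universalGradingGroup_of_mul_of_eq ?_
    rcases hδ.eq_or_eq z.rep inferInstance hz with h | h <;> rw [h]
    · rw [one_mul]
    · exact hX
  exact mul_eq_right.1 this

/-- The degrees of simple objects already form a subgroup. Products come from constituents of `x ⊗
y`; for inverses, a constituent `y` of the dual of `x` makes every constituent of `x ⊗ y` lie in the
trivial component, where `of_eq_one` applies. -/
theorem exists_of_eq (hδ : 𝒢.IsGeneratedByInvolution δ) (k : Type u) [Field k]
    [IsAlgClosed k] [Linear k C] [MonoidalLinear k C] [IsFusionCategory k C] {X : C} [Simple X]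
    (hX : ¬ IsUnit (toSkeleton X)) (u : UniversalGradingGroup C) :
    ∃ x : Irr C, PresentedGroup.of x = u := by
  have h1 : Simple (𝟙_ C) := IsFusionCategory.simple_unit k
  have hmul : ∀ x y : Irr C, ∃ z : Irr C, ∃ f : z.rep ⟶ x.rep ⊗ y.rep, f ≠ 0 := by
    intro x y
    obtain ⟨S, hS, f, hf⟩ := exists_simple_hom_ne_zero k
      (not_isZero_tensor (Simple.not_isZero x.rep) (Simple.not_isZero y.rep))
    obtain ⟨z, ⟨e⟩⟩ := Irr.exists_rep_iso S
    refine ⟨z, e.hom ≫ f, fun h => hf ?_⟩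
    rwa [Preadditive.IsIso.comp_left_eq_zero] at h
  let H : Subgroup (UniversalGradingGroup C) :=
    { carrier := {u | ∃ x : Irr C, PresentedGroup.of x = u}
      mul_mem' := by
        rintro _ _ ⟨x, rfl⟩ ⟨y, rfl⟩
        obtain ⟨z, f, hf⟩ := hmul x y
        exact ⟨z, (universalGradingGroup_of_mul hf).symm⟩
      one_mem' := by
        obtain ⟨z, ⟨e⟩⟩ := Irr.exists_rep_iso (𝟙_ C)
        exact ⟨z, hδ.of_eq_one k hX (𝒢.of_iso _ _ _ e.symm (𝒢.unit_mem h1))⟩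
      inv_mem' := by
        rintro _ ⟨x, rfl⟩
        have hxd : ¬ IsZero (x.repᘁ) := fun h =>
          coevaluation_ne_zero (X := x.rep) (Y := x.repᘁ) (Simple.not_isZero x.rep)
            (((tensorLeft x.rep).map_isZero h).eq_of_tgt _ _)
        obtain ⟨S, hS, f, hf⟩ := exists_simple_hom_ne_zero k hxd
        obtain ⟨y, ⟨e⟩⟩ := Irr.exists_rep_iso S
        have hS' := (𝒢.component_iff_of_hom_ne_zero hf
          ((𝒢.dual _ _).1 (𝒢.component_degree x))).2 rfl
        have hy := 𝒢.of_iso _ _ _ e.symm hS'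
        obtain ⟨z, g, hg⟩ := hmul x y
        have hz : 𝒢.component 1 z.rep := (𝒢.component_iff_of_hom_ne_zero hg
          (𝒢.tensor _ _ _ _ (𝒢.component_degree x) hy)).2 (by simp)
        refine ⟨y, (inv_eq_of_mul_eq_one_right ?_).symm⟩
        rw [universalGradingGroup_of_mul hg, hδ.of_eq_one k hX hz] }
  exact PresentedGroup.generated_by _ H (fun x => ⟨x, rfl⟩) u

/-- A kernel element is the universal degree of a simple object of the trivial component, hence 1;
surjectivity is faithfulness. -/
theorem universalHom_bijective (hδ : 𝒢.IsGeneratedByInvolution δ) (h𝒢 : 𝒢.IsFaithful) (k : Type u)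
    [Field k] [IsAlgClosed k] [Linear k C] [MonoidalLinear k C] [IsFusionCategory k C] {X : C}
    [Simple X] (hX : ¬ IsUnit (toSkeleton X)) : Function.Bijective 𝒢.universalHom := by
  constructor
  · rw [injective_iff_map_eq_one]
    intro u hu
    obtain ⟨x, rfl⟩ := hδ.exists_of_eq k hX u
    rw [universalHom_of, degree_eq_iff] at hu
    exact hδ.of_eq_one k hX hu
  · intro g
    obtain ⟨x, hx⟩ := h𝒢.exists_degree_eq k g
    exact ⟨PresentedGroup.of x, by rw [universalHom_of, hx]⟩

theorem universalComponent_eq (hδ : 𝒢.IsGeneratedByInvolution δ) (h𝒢 : 𝒢.IsFaithful) (k : Type u)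
    [Field k] [IsAlgClosed k] [Linear k C] [MonoidalLinear k C] [IsFusionCategory k C] {X : C}
    [Simple X] (hX : ¬ IsUnit (toSkeleton X)) (u : UniversalGradingGroup C) :
    universalComponent C u = 𝒢.component (𝒢.universalHom u) := by
  ext Y
  rw [𝒢.component_iff_simple k, universalComponent]
  have key : ∀ z : Irr C, PresentedGroup.of z = u ↔
      𝒢.component (𝒢.universalHom u) z.rep := fun z => by
    rw [← degree_eq_iff, ← universalHom_of, (hδ.universalHom_bijective h𝒢 k hX).1.eq_iff]
  simp only [key]
  constructor
  · rintro H S hS ⟨f, hf⟩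
    obtain ⟨z, ⟨e⟩⟩ := Irr.exists_rep_iso S
    refine 𝒢.of_iso _ _ _ e (H z ⟨e.hom ≫ f, fun h => hf ?_⟩)
    rwa [Preadditive.IsIso.comp_left_eq_zero] at h
  · exact fun H z hz => H z.rep inferInstance hz

/-- For non-invertible `X`, `δ` is a summand of `X ⊗ Xᘁ`, so a fusion subcategory containing that
product contains `𝟙` and `δ`, hence the whole trivial component. Conversely the trivial component is
a fusion subcategory containing every `Z ⊗ Zᘁ` with `Z` simple. -/
theorem component_one_eq_adjointSubcategory (hδ : 𝒢.IsGeneratedByInvolution δ) (k : Type u)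
    [Field k] [IsAlgClosed k] [Linear k C] [MonoidalLinear k C] [IsFusionCategory k C] {X : C}
    [Simple X] (hX : ¬ IsUnit (toSkeleton X)) : 𝒢.component 1 = adjointSubcategory C := by
  classical
  have := finiteDimensional_hom_of_isFusionCategory k (C := C)
  have h1 : Simple (𝟙_ C) := IsFusionCategory.simple_unit k
  have hδ' : Simple δ := simple_of_isUnit hδ.isUnit
  ext Y
  constructor
  · intro hY P hP hPX
    have hiso : ∀ {A B : C}, toSkeleton A = toSkeleton B → P A → P B := fun h hA => by
      obtain ⟨e⟩ := toSkeleton_eq_toSkeleton_iff.1 h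
      exact hP.summand _ _ hA ⟨⟨e.inv, e.hom, e.inv_hom_id⟩⟩
    obtain ⟨g, hg⟩ := 𝒢.exists_component X
    have hXX : 𝒢.component 1 (X ⊗ Xᘁ) := by
      simpa using 𝒢.tensor _ _ _ _ hg ((𝒢.dual _ _).1 hg)
    have hPδ : P δ := by
      obtain ⟨n, S, -, hS, hS1, ⟨e⟩⟩ := hδ.exists_decomposition k hXX
      have hδX : Simple (δ ⊗ X) := simple_tensor_of_isUnit_left hδ.isUnit X
      have hpos : Module.finrank k (δ ⟶ X ⊗ Xᘁ) = 1 := by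
        rw [hδ.isUnit_iff k, not_not] at hX
        rw [← finrank_tensorRight_hom k δ X (Xᘁ) X, finrank_hom_simple,
          Skeleton.toSkeleton_tensorObj, if_pos hX]
      rw [finrank_hom_congr k (Iso.refl δ) e, finrank_hom_biproduct] at hpos
      obtain ⟨i, -, hi⟩ := Finset.exists_ne_zero_of_sum_ne_zero (hpos.trans_ne one_ne_zero)
      rw [finrank_hom_simple] at hi
      refine hiso (by simpa [eq_comm] using hi) (hP.summand _ (S i) (hPX X inferInstance)
        ⟨⟨biproduct.ι S i ≫ e.inv, e.hom ≫ biproduct.π S i, by simp⟩⟩)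
    obtain ⟨n, S, -, hS, hS1, ⟨e⟩⟩ := hδ.exists_decomposition k hY
    refine hP.summand _ _ (hP.biproduct S fun i => ?_) ⟨⟨e.hom, e.inv, e.hom_inv_id⟩⟩
    rcases hδ.eq_or_eq _ (hS i) (hS1 i) with h | h
    · exact hiso (h.trans Skeleton.one_eq).symm hP.unit
    · exact hiso h.symm hPδ
  · intro hY
    refine hY _ (𝒢.isFusionSubcategory_component_one h1) fun Z hZ => ?_
    obtain ⟨g, hg⟩ := 𝒢.exists_component Z
    simpa using 𝒢.tensor _ _ _ _ hg ((𝒢.dual _ _).1 hg)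

end IsGeneratedByInvolution

end FusionGrading

/-! ### Counting simple objects by degree. -/

theorem card_isUnit_irr {C : Type v} [Category.{w} C] [HasZeroMorphisms C] [MonoidalCategory C]
    [Simple (𝟙_ C)] :
    Nat.card {x : Irr C // IsUnit (toSkeleton x.rep)} = Nat.card (InvertibleGroup C) := by
  refine Nat.card_congr (Equiv.ofBijective (fun x => x.2.unit) ⟨?_, ?_⟩)
  · intro x y h
    exact Subtype.ext (Irr.eq_iff.2 (congrArg Units.val h))
  · intro u
    obtain ⟨X, hX⟩ := Quotient.exists_rep (u : Skeleton C)
    change toSkeleton X = _ at hX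
    have hu : IsUnit (toSkeleton X) := hX ▸ u.isUnit
    have := simple_of_isUnit hu
    obtain ⟨x, ⟨e⟩⟩ := Irr.exists_rep_iso X
    have hx := congr_toSkeleton_of_iso e
    exact ⟨⟨x, hx ▸ hu⟩, Units.ext (hx.trans hX)⟩

namespace FusionGrading

variable {G : Type t} [Group G] [Finite G] {C : Type v} [Category.{w} C] [Abelian C]
  [MonoidalCategory C] [RigidCategory C] (𝒢 : FusionGrading G C)

/-- The degrees of the invertible objects. -/
def invertibleDegrees : Set G := {g | ∃ X : C, IsUnit (toSkeleton X) ∧ 𝒢.component g X}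

namespace IsGeneratedByInvolution

variable {𝒢} {δ : C} [MonoidalPreadditive C]

theorem notMem_invertibleDegrees (hδ : 𝒢.IsGeneratedByInvolution δ) (k : Type u) [Field k]
    [IsAlgClosed k] [Linear k C] [MonoidalLinear k C] [IsFusionCategory k C] {X : C} [Simple X]
    (hX : ¬ IsUnit (toSkeleton X)) {g : G} (hg : 𝒢.component g X) :
    g ∉ 𝒢.invertibleDegrees := by
  rintro ⟨Y, hY, hYg⟩
  have h1 : Simple (𝟙_ C) := IsFusionCategory.simple_unit k
  have := simple_of_isUnit hY
  rw [hδ.eq_of_not_isUnit k hg hYg hX] at hY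
  exact hX hY

/-- A degree carrying an invertible object `A` carries exactly two classes, those of `A` and `A ⊗
δ`, labelled below by `true` and `false`. -/
theorem card_invertibleGroup (hδ : 𝒢.IsGeneratedByInvolution δ) (k : Type u) [Field k]
    [IsAlgClosed k] [Linear k C] [MonoidalLinear k C] [IsFusionCategory k C] :
    Nat.card (InvertibleGroup C) = 2 * 𝒢.invertibleDegrees.ncard := by
  have h1 : Simple (𝟙_ C) := IsFusionCategory.simple_unit k
  have hchoice : ∀ g : 𝒢.invertibleDegrees, ∃ X : C, IsUnit (toSkeleton X) ∧
      𝒢.component g X := fun g => g.2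
  choose A hAu hAg using hchoice
  let D : Bool → C := fun b => if b then 𝟙_ C else δ
  have hDu : ∀ b, IsUnit (toSkeleton (D b)) := by
    rintro (_ | _)
    · exact hδ.isUnit
    · exact isUnit_one
  have hD1 : ∀ b, 𝒢.component 1 (D b) := by
    rintro (_ | _)
    · exact hδ.mem
    · exact 𝒢.unit_mem h1
  have hmem : ∀ (g : 𝒢.invertibleDegrees) (b : Bool), 𝒢.component g (A g ⊗ D b) := fun g b => by
    simpa using 𝒢.tensor _ _ _ _ (hAg g) (hD1 b)
  have hu : ∀ g b, IsUnit (toSkeleton (A g ⊗ D b)) := fun g b => by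
    rw [Skeleton.toSkeleton_tensorObj]
    exact (hAu g).mul (hDu b)
  have hbij : Function.Bijective
      (fun p : 𝒢.invertibleDegrees × Bool => (hu p.1 p.2).unit) := by
    constructor
    · rintro ⟨g, b⟩ ⟨h, c⟩ hgh
      have hsk : toSkeleton (A g ⊗ D b) = toSkeleton (A h ⊗ D c) := congrArg Units.val hgh
      obtain ⟨e⟩ := toSkeleton_eq_toSkeleton_iff.1 hsk
      have hs := simple_of_isUnit (hu h c)
      have hEq : g = h := Subtype.ext (𝒢.component_unique (Simple.not_isZero _)
        (𝒢.of_iso _ _ _ e (hmem g b)) (hmem h c))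
      subst hEq
      rw [Skeleton.toSkeleton_tensorObj, Skeleton.toSkeleton_tensorObj] at hsk
      have hbc := (hAu g).mul_left_cancel hsk
      have hbc' : b = c := by
        cases b <;> cases c
        · rfl
        · exact absurd hbc hδ.ne_one
        · exact absurd hbc.symm hδ.ne_one
        · rfl
      rw [hbc']
    · intro u
      obtain ⟨X, hX⟩ := Quotient.exists_rep (u : Skeleton C)
      change toSkeleton X = _ at hX
      have hXu : IsUnit (toSkeleton X) := hX ▸ u.isUnit
      have := simple_of_isUnit hXu
      obtain ⟨g, hg⟩ := 𝒢.exists_component X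
      have := simple_of_isUnit (hAu ⟨g, X, hXu, hg⟩)
      rcases hδ.eq_or_eq_mul_right k (hAg ⟨g, X, hXu, hg⟩) hg with h | h
      · refine ⟨(⟨g, X, hXu, hg⟩, true), Units.ext (Eq.trans ?_ hX)⟩
        exact (congr_toSkeleton_of_iso (ρ_ _)).trans h.symm
      · refine ⟨(⟨g, X, hXu, hg⟩, false), Units.ext (Eq.trans ?_ hX)⟩
        exact (Skeleton.toSkeleton_tensorObj _ _).trans h.symm
  rw [← Nat.card_congr (Equiv.ofBijective _ hbij), Nat.card_prod, Nat.card_coe_set_eq,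
    Nat.card_eq_fintype_card (α := Bool), Fintype.card_bool, mul_comm]

/-- A non-invertible simple object is alone in its component, so it is determined by its degree; by
faithfulness every degree without invertible objects occurs. -/
theorem card_not_isUnit (hδ : 𝒢.IsGeneratedByInvolution δ) (h𝒢 : 𝒢.IsFaithful) (k : Type u)
    [Field k] [IsAlgClosed k] [Linear k C] [MonoidalLinear k C] [IsFusionCategory k C] :
    Nat.card {x : Irr C // ¬ IsUnit (toSkeleton x.rep)} = 𝒢.invertibleDegreesᶜ.ncard := by
  rw [← Nat.card_coe_set_eq]
  refine Nat.card_congr (Equiv.ofBijective (fun x => ⟨𝒢.degree x.1,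
    hδ.notMem_invertibleDegrees k x.2 (𝒢.component_degree x.1)⟩) ⟨?_, ?_⟩)
  · intro x y hxy
    have hxy' : 𝒢.degree x.1 = 𝒢.degree y.1 := congrArg Subtype.val hxy
    exact Subtype.ext (Irr.eq_iff.2 (hδ.eq_of_not_isUnit k (𝒢.component_degree y.1)
      (hxy' ▸ 𝒢.component_degree x.1) y.2))
  · rintro ⟨g, hg⟩
    obtain ⟨x, hx⟩ := h𝒢.exists_degree_eq k g
    exact ⟨⟨x, fun hxu => hg ⟨x.rep, hxu, 𝒢.degree_eq_iff.1 hx⟩⟩, Subtype.ext hx⟩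

/-- Right multiplication by the degree of `X` exchanges the two sets: invertible times `X` is simple
and non-invertible, while non-invertible times `X` has invertible summands. -/
theorem ncard_compl_invertibleDegrees (hδ : 𝒢.IsGeneratedByInvolution δ) (h𝒢 : 𝒢.IsFaithful)
    (k : Type u) [Field k] [IsAlgClosed k] [Linear k C] [MonoidalLinear k C]
    [IsFusionCategory k C] {X : C} [Simple X] (hX : ¬ IsUnit (toSkeleton X)) :
    𝒢.invertibleDegreesᶜ.ncard = 𝒢.invertibleDegrees.ncard := by
  obtain ⟨g₀, hg₀⟩ := 𝒢.exists_component X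
  have h1 : ∀ g ∈ 𝒢.invertibleDegrees, g * g₀ ∉ 𝒢.invertibleDegrees := by
    rintro g ⟨Y, hY, hYg⟩
    have := simple_tensor_of_isUnit_left hY X
    refine hδ.notMem_invertibleDegrees k (X := Y ⊗ X) ?_ (𝒢.tensor _ _ _ _ hYg hg₀)
    obtain ⟨u, hu⟩ := hY
    rwa [Skeleton.toSkeleton_tensorObj, ← hu, Units.isUnit_units_mul]
  have h2 : ∀ g ∉ 𝒢.invertibleDegrees, g * g₀ ∈ 𝒢.invertibleDegrees := by
    intro g hg
    obtain ⟨y, hy⟩ := h𝒢.exists_degree_eq k g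
    rw [degree_eq_iff] at hy
    obtain ⟨S, hS, ⟨e⟩⟩ := hδ.tensor_of_not_isUnit k (X := y.rep) (fun h => hg ⟨_, h, hy⟩) hX
    exact ⟨S 0, hS 0, 𝒢.component_of_retract
      ⟨biproduct.ι S 0 ≫ e.inv, e.hom ≫ biproduct.π S 0, by simp⟩ (𝒢.tensor _ _ _ _ hy hg₀)⟩
  have himage : (fun g => g * g₀) '' 𝒢.invertibleDegrees = 𝒢.invertibleDegreesᶜ := by
    ext g
    constructor
    · rintro ⟨h, hh, rfl⟩
      exact h1 h hh
    · intro hg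
      refine ⟨g * g₀⁻¹, ?_, by simp⟩
      by_contra hcon
      exact hg (by simpa using h2 _ hcon)
  rw [← himage, Set.ncard_image_of_injective _ (mul_left_injective g₀)]

theorem isGeneralizedTambaraYamagami (hδ : 𝒢.IsGeneratedByInvolution δ) (k : Type u)
    [Field k] [IsAlgClosed k] [Linear k C] [MonoidalLinear k C] [IsFusionCategory k C]
    (h : ¬ IsPointed C) : IsGeneralizedTambaraYamagami C := by
  have h1 : Simple (𝟙_ C) := IsFusionCategory.simple_unit k
  refine ⟨h, fun X Y hX hY hX' hY' => ?_⟩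
  rw [hδ.isInvertibleObj_iff_isUnit k] at hX' hY'
  obtain ⟨S, hS, e⟩ := hδ.tensor_of_not_isUnit k hX' hY'
  refine ⟨2, S, fun i => ?_, e⟩
  have := simple_of_isUnit (hS i)
  exact (hδ.isInvertibleObj_iff_isUnit k (S i)).2 (hS i)

theorem isOfType (hδ : 𝒢.IsGeneratedByInvolution δ) (k : Type u)
    [Field k] [IsAlgClosed k] [Linear k C] [MonoidalLinear k C] [IsFusionCategory k C] {n m : ℕ}
    (hn : Nat.card {x : Irr C // IsUnit (toSkeleton x.rep)} = n)
    (hm : Nat.card {x : Irr C // ¬ IsUnit (toSkeleton x.rep)} = m) (hn0 : 0 < n) (hm0 : 0 < m) :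
    IsOfType k C ![1, √2] ![n, m] := by
  have h12 : (1 : ℝ) < √2 := Real.one_lt_sqrt_two
  have hdim : ∀ x : Irr C, (FPdim k x.rep = 1 ↔ IsUnit (toSkeleton x.rep)) ∧
      (FPdim k x.rep = √2 ↔ ¬ IsUnit (toSkeleton x.rep)) := fun x => by
    rw [hδ.FPdim_eq k, simpleDim]
    by_cases h : IsUnit (toSkeleton x.rep)
    · simp [h, h12.ne]
    · simp [h, h12.ne']
  refine ⟨rfl, ?_, ?_, ?_, fun x => ?_⟩
  · intro i j hij
    fin_cases i <;> fin_cases j <;> simp_all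
  · intro i
    fin_cases i
    · exact hn0
    · exact hm0
  · intro i
    fin_cases i
    · exact (Nat.card_congr (Equiv.subtypeEquivRight fun x => (hdim x).1)).trans hn
    · exact (Nat.card_congr (Equiv.subtypeEquivRight fun x => (hdim x).2)).trans hm
  · by_cases h : IsUnit (toSkeleton x.rep)
    · exact ⟨0, (hdim x).1.2 h⟩
    · exact ⟨1, (hdim x).2.2 h⟩

end IsGeneratedByInvolution

end FusionGrading

theorem mainTheorem2 {k : Type u} [Field k] [IsAlgClosed k] [CharZero k]
    {C : Type v} [Category.{w} C] [Abelian C] [Linear k C] [MonoidalCategory C]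
    [MonoidalPreadditive C] [MonoidalLinear k C] [RigidCategory C] [IsFusionCategory k C]
    {G : Type t} [Group G] [Finite G] (𝒢 : FusionGrading G C)
    (ω : ThreeCocycle (Multiplicative (ZMod 2)) k)
    (h𝒢 : 𝒢.IsExtensionOf k (TwistedVect ω)) :
    (¬ ω.IsTrivial → IsPointed C) ∧
    (ω.IsTrivial →
      (IsPointed C ∨ IsGeneralizedTambaraYamagami C) ∧
      (IsGeneralizedTambaraYamagami C →
        ∃ n : ℕ,
          Nat.card (InvertibleGroup C) = 2 * n ∧
          IsOfType k C ![1, √2] ![2 * n, n] ∧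
          𝒢.component 1 = adjointSubcategory C ∧
          (∃ e : UniversalGradingGroup C ≃* G,
            ∀ u : UniversalGradingGroup C, universalComponent C u = 𝒢.component (e u)) ∧
          Nat.card (UniversalGradingGroup C) = 2 * n)) := by
  have h1 : Simple (𝟙_ C) := IsFusionCategory.simple_unit k
  obtain ⟨δ, hδ, hω⟩ := h𝒢.exists_isGeneratedByInvolution
  have hfaith : 𝒢.IsFaithful := h𝒢.1
  refine ⟨fun hnt X hX => ?_, fun _ => ⟨?_, fun hGTY => ?_⟩⟩
  · exact (hδ.isInvertibleObj_iff k X).2 fun h => hnt (hω X hX h)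
  · by_cases h : IsPointed C
    · exact Or.inl h
    · exact Or.inr (hδ.isGeneralizedTambaraYamagami k h)
  · obtain ⟨X, hX, hXu⟩ : ∃ X : C, Simple X ∧ ¬ IsUnit (toSkeleton X) := by
      by_contra! hcon
      exact hGTY.1 fun X hX => (hδ.isInvertibleObj_iff_isUnit k X).2 (hcon X hX)
    have hbij := hδ.universalHom_bijective hfaith k hXu
    have hcompl := hδ.ncard_compl_invertibleDegrees hfaith k hXu
    have hinv := hδ.card_invertibleGroup k
    -- The integer `n` is the number of degrees carrying invertible objects; the unit object shows
    -- that it is at least 1.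
    have hpos : 0 < 𝒢.invertibleDegrees.ncard :=
      (Set.ncard_pos).2 ⟨1, 𝟙_ C, isUnit_one, 𝒢.unit_mem h1⟩
    refine ⟨𝒢.invertibleDegrees.ncard, hinv, ?_,
      hδ.component_one_eq_adjointSubcategory k hXu, ⟨MulEquiv.ofBijective _ hbij,
        fun u => hδ.universalComponent_eq hfaith k hXu u⟩, ?_⟩
    · exact hδ.isOfType k (card_isUnit_irr.trans hinv)
        ((hδ.card_not_isUnit hfaith k).trans hcompl) (by omega) hpos
    -- `G` splits into the degrees carrying invertible objects and the equally many others.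
    · rw [Nat.card_congr (Equiv.ofBijective _ hbij), ← Set.ncard_add_ncard_compl
        𝒢.invertibleDegrees, hcompl, two_mul]
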